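/- Let $S$ denote area. For a closed planar region $A$ of finite area let the packing waste be $W(A)=S(A)-\sup S(A_\lambda)$, where the supremum is over all sets $A_\lambda\subset A$ that are unions of non-overlapping (that is, with pairwise disjoint interiors) closed unit squares in arbitrary position. For $h,a>0$ and $0<\theta<\pi/2$ let $T(h,a,\theta)$ be the trapezoid with vertices $(0,0)$, $(0,h)$, $(a,h)$, $(a+h\tan\theta,0)$: it has height $h$, a top edge of length $a$, a vertical left-hand side, and a right-hand side at angle $\theta$ to the vertical. The relation $\sim$ means that the quotient of the two sides tends to $1$ as $x\to\infty$. (i) Let $c\le 7$, $x>0$ and $x^{3/4}\le x'\le cx$. Every rectangle $T_1$ of length $x$ and width $x'$ satisfies $W(T_1)\le\big((15+c)\sqrt2+38\big)x^{5/8}$. (ii) Let $x'=x'(x)$ and $\theta=\theta(x)$ be functions of $x$ with $x'\sim 2x^{1/2}$ and, for all sufficiently large $x$, $0<\theta<\sqrt2\,x^{-1/2}$. Then for all sufficiently large $x$ the trapezoid $T_2=T(x,x',\theta)$ satisfies $W(T_2)\le\big(\tfrac{19}{2}+\tfrac72\sqrt2\big)x^{5/6}$. (iii) Let $h=h(x)$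 and $\theta=\theta(x)$ be functions of $x$ with $h\sim\frac12x^{1/2}$ and, for all sufficiently large $x$, $0<\theta<\sqrt2\,x^{-1/2}$, and let $a=\lfloor x^{1/3}+\sqrt2\,x^{1/6}\rfloor$. Then for all sufficiently large $x$ the trapezoid $T_3=T(h,a,\theta)$ satisfies $W(T_3)\le\big(\tfrac{19}{4}+\tfrac74\sqrt2\big)x^{1/3}$. In particular, for every $x>0$ the packing waste $W(x)$ of a square of side length $x$ satisfies $W(x)\le(16\sqrt2+38)x^{5/8}$; hence $W(x)=O(x^{5/8})$ as $x\to\infty$. -/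

import Mathlib

open Filter Asymptotics MeasureTheory

/-- The Euclidean plane. -/
abbrev Plane : Type := EuclideanSpace ℝ (Fin 2)

/-- A closed unit square in the plane, in arbitrary position: it has a corner `p` and
orthonormal edge vectors `u`, `v`. -/
def IsUnitSquare (Q : Set Plane) : Prop :=
  ∃ p u v : Plane, ‖u‖ = 1 ∧ ‖v‖ = 1 ∧ inner ℝ u v = 0 ∧
    Q = {q | ∃ s ∈ Set.Icc (0 : ℝ) 1, ∃ t ∈ Set.Icc (0 : ℝ) 1, q = p + s • u + t • v}

/-- `𝒬` is a packing of unit squares into `A`: a family of unit squares contained in `A`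
that do not overlap (their interiors are pairwise disjoint). -/
def IsPacking (A : Set Plane) (𝒬 : Set (Set Plane)) : Prop :=
  (∀ Q ∈ 𝒬, IsUnitSquare Q ∧ Q ⊆ A) ∧ 𝒬.PairwiseDisjoint interior

/-- The packing waste `W(A)` of a planar region `A` (of finite area): the area of `A` minus the
supremum of the areas of the unions of non-overlapping unit squares contained in `A`. -/
noncomputable def packingWaste (A : Set Plane) : ℝ :=
  volume.real A - sSup {s : ℝ | ∃ 𝒬 : Set (Set Plane), IsPacking A 𝒬 ∧ s = volume.real (⋃₀ 𝒬)}

/-- The closed rectangle of length `l` and width `w`. -/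
def rectangle (l w : ℝ) : Set Plane :=
  {p | 0 ≤ p 0 ∧ p 0 ≤ l ∧ 0 ≤ p 1 ∧ p 1 ≤ w}

/-- The closed trapezoid with horizontal parallel edges, of height `h`, with top edge of length
`a`, vertical left-hand side, and right-hand side running downwards and outwards at the angle `θ`
to the vertical. Its vertices are `(0, 0)`, `(0, h)`, `(a, h)` and `(a + h * tan θ, 0)`. -/
def trapezoid (h a θ : ℝ) : Set Plane :=
  {p | 0 ≤ p 1 ∧ p 1 ≤ h ∧ 0 ≤ p 0 ∧ p 0 ≤ a + (h - p 1) * Real.tan θ}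

/-!
If `N` non-overlapping unit squares fit into `A`, then the waste of `A` is at most the area of `A`
minus `N` (`Packs.packingWaste_le`). So everything comes down to packing many squares into
rectangles and trapezoids.

*Steep trapezoids.* Let the top edge be `b` and let the side deviate from the vertical by at most
`3 / 4` in all. Take `n = ⌊b⌋ + 2` and tilt a row of `n` squares, with direction `(c, s)`, such that
it spans the width `b` exactly: `n c + s = b`, so that `s` is about `2 / √b`. If the first `k`
squares of the row are replaced by squares in vertical columns, the row gets longer by `k (1 - c)`,
a small quantity of the order `k / b`. Hence rows of one and the same direction can follow
the slanted side closely: the lower the row, the more squares it drops at its left end. No wedges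
between rows arise. Vertical columns fill the staircase left behind by the dropped squares, and
the triangles above and below the rows. Besides lower terms, the waste consists of two small
triangles at the ends of each row and of the rounding of the heights of the columns. The order is
`b + h / √b` (`packs_tilted_rows`, `exists_packs_steep_trapezoid`). With `h` about `x ^ (1 / 2) / 2`
and `b` about `x ^ (1 / 3)` this is the bound `O(x ^ (1 / 3))`.

*Tall trapezoids.* A trapezoid of height `X` whose side has slope at most `(3 / 2) X ^ (-1 / 2)` is
cut into about `2 X ^ (1 / 2)` slabs of integer height about `X ^ (1 / 2) / 2`. Each slab is the
union of a rectangle with integer sides and a steep trapezoid with top edge about `X ^ (1 / 3)`. The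
total waste is `O(X ^ (5 / 6))` (`exists_packs_tall_trapezoid`).

*Rectangles.* Cutting off a rectangle with integer sides leaves two strips along the edges, of
width about `Y`. In a strip, columns of `⌊Y⌋ + 1` squares, tilted so that they just fit, waste at
most about `√2 Y ^ (-1 / 2)` each, and leave a trapezoid of height `Y` at either end
(`exists_packs_rectangle`). For `Y = x ^ (3 / 4)` the columns and the ends, as tall trapezoids, both
waste `O(x ^ (5 / 8))`. This estimate needs `x` to be large. For moderate `x` the choice
`Y = x ^ (2 / 3)`, with end trapezoids packed by aligned rows, wastes a small multiple of
`x ^ (2 / 3)`, and for small `x` aligned rows alone suffice; so the bound holds for every `x > 0`.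
-/

/-! ### Packings and separation -/

/-- `A` contains `N` non-overlapping unit squares. -/
def Packs (A : Set Plane) (N : ℕ) : Prop :=
  ∃ 𝒬 : Finset (Set Plane), IsPacking A (𝒬 : Set (Set Plane)) ∧ 𝒬.card = N

theorem IsUnitSquare.volume_and_convex {Q : Set Plane} (hQ : IsUnitSquare Q) :
    volume Q = 1 ∧ Convex ℝ Q := by
  obtain ⟨p, u, v, hu, hv, huv, rfl⟩ := hQ
  have hon : Orthonormal ℝ ![u, v] := by
    rw [orthonormal_iff_ite]
    intro i j
    fin_cases i <;> fin_cases j <;> simp [hu, hv, huv, real_inner_comm]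
  have hcard : Fintype.card (Fin 2) = Module.finrank ℝ Plane := by simp
  let b := basisOfOrthonormalOfCardEqFinrank hon hcard
  have hb : ⇑b = ![u, v] := coe_basisOfOrthonormalOfCardEqFinrank hon hcard
  let o := b.toOrthonormalBasis (by rw [hb]; exact hon)
  have ho : ⇑o = ![u, v] := by simp [o, hb]
  have key : {q | ∃ s ∈ Set.Icc (0 : ℝ) 1, ∃ t ∈ Set.Icc (0 : ℝ) 1, q = p + s • u + t • v}
      = (fun x => p + x) '' parallelepiped o := by
    ext q
    simp only [Set.mem_ofPred_eq, Set.mem_image, mem_parallelepiped_iff, ho, Fin.sum_univ_two,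
      Matrix.cons_val_zero, Matrix.cons_val_one]
    constructor
    · rintro ⟨s, hs, t, ht, rfl⟩
      refine ⟨s • u + t • v, ⟨![s, t], ?_, by simp⟩, by abel⟩
      constructor <;> intro i <;> fin_cases i <;> simp [hs.1, hs.2, ht.1, ht.2]
    · rintro ⟨_, ⟨w, hw, rfl⟩, rfl⟩
      exact ⟨w 0, ⟨hw.1 0, hw.2 0⟩, w 1, ⟨hw.1 1, hw.2 1⟩, by abel⟩
  rw [key]
  constructor
  · rw [Set.image_add_left, measure_preimage_add]
    exact o.volume_parallelepiped
  · rw [parallelepiped_eq_convexHull]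
    exact (convex_convexHull ℝ _).translate p

theorem IsUnitSquare.volume_interior {Q : Set Plane} (hQ : IsUnitSquare Q) :
    volume (interior Q) = 1 := by
  rw [← hQ.volume_and_convex.1]
  exact measure_congr (interior_ae_eq_of_null_frontier
    (hQ.volume_and_convex.2.addHaar_frontier volume))

theorem IsUnitSquare.interior_nonempty {Q : Set Plane} (hQ : IsUnitSquare Q) :
    (interior Q).Nonempty := by
  rw [Set.nonempty_iff_ne_empty]
  intro h
  have := hQ.volume_interior
  simp [h] at this

theorem volume_real_le_of_isPacking {A : Set Plane} (hA : volume A ≠ ⊤) {𝒬 : Set (Set Plane)}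
    (h : IsPacking A 𝒬) : volume.real (⋃₀ 𝒬) ≤ volume.real A :=
  measureReal_mono (Set.sUnion_subset fun Q hQ => (h.1 Q hQ).2) hA

theorem packingWaste_nonneg {A : Set Plane} (hA : volume A ≠ ⊤) : 0 ≤ packingWaste A := by
  refine sub_nonneg.2 (Real.sSup_le ?_ measureReal_nonneg)
  rintro _ ⟨𝒬, h, rfl⟩
  exact volume_real_le_of_isPacking hA h

/-- Overlaps of the squares are confined to their boundaries, which have measure zero, so that the
area covered by a finite packing is the number of its squares. -/
theorem Packs.packingWaste_le {A : Set Plane} (hA : volume A ≠ ⊤) {N : ℕ} (h : Packs A N) :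
    packingWaste A ≤ volume.real A - N := by
  obtain ⟨𝒬, h𝒬, rfl⟩ := h
  refine sub_le_sub_left ?_ _
  have hfin : volume (⋃₀ (𝒬 : Set (Set Plane))) ≠ ⊤ :=
    ne_top_of_le_ne_top hA (measure_mono (Set.sUnion_subset fun Q hQ => (h𝒬.1 Q hQ).2))
  have h1 : ((𝒬.card : ℕ) : ENNReal) ≤ volume (⋃₀ (𝒬 : Set (Set Plane))) := by
    calc ((𝒬.card : ℕ) : ENNReal) = ∑ Q ∈ 𝒬, volume (interior Q) := by
          rw [Finset.sum_congr rfl fun Q hQ => (h𝒬.1 Q hQ).1.volume_interior]; simp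
      _ = volume (⋃ Q ∈ 𝒬, interior Q) :=
          (measure_biUnion_finset h𝒬.2 fun Q _ => isOpen_interior.measurableSet).symm
      _ ≤ _ := by
          refine measure_mono (Set.iUnion₂_subset fun Q hQ => ?_)
          exact interior_subset.trans (Set.subset_sUnion_of_mem hQ)
  have h2 : ((𝒬.card : ℕ) : ℝ) ≤ volume.real (⋃₀ (𝒬 : Set (Set Plane))) := by
    have := ENNReal.toReal_mono hfin h1
    simpa [Measure.real] using this
  refine h2.trans (le_csSup ⟨volume.real A, ?_⟩ ⟨_, h𝒬, rfl⟩)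
  rintro _ ⟨𝒬', h', rfl⟩
  exact volume_real_le_of_isPacking hA h'

theorem Packs.mono {A B : Set Plane} {N : ℕ} (h : Packs A N) (hAB : A ⊆ B) : Packs B N := by
  obtain ⟨𝒬, h𝒬, hN⟩ := h
  exact ⟨𝒬, ⟨fun Q hQ => ⟨(h𝒬.1 Q hQ).1, (h𝒬.1 Q hQ).2.trans hAB⟩, h𝒬.2⟩, hN⟩

theorem IsUnitSquare.packs {Q : Set Plane} (hQ : IsUnitSquare Q) : Packs Q 1 :=
  ⟨{Q}, by simp [IsPacking, hQ], rfl⟩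

/-- `A` and `B` lie on different sides of some line. -/
def Separated (A B : Set Plane) : Prop :=
  ∃ α β γ : ℝ, (α ≠ 0 ∨ β ≠ 0) ∧ (∀ p ∈ A, α * p 0 + β * p 1 ≤ γ) ∧
    ∀ p ∈ B, γ ≤ α * p 0 + β * p 1

theorem Separated.symm {A B : Set Plane} (h : Separated A B) : Separated B A := by
  obtain ⟨α, β, γ, h0, hA, hB⟩ := h
  refine ⟨-α, -β, -γ, by simpa using h0, fun p hp => ?_, fun p hp => ?_⟩
  · linarith [hB p hp]
  · linarith [hA p hp]

theorem Separated.disjoint_interior {A B : Set Plane} (h : Separated A B) :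
    Disjoint (interior A) (interior B) := by
  obtain ⟨α, β, γ, h0, hA, hB⟩ := h
  rw [Set.disjoint_left]
  intro p hpA hpB
  -- moving from `p` in the direction `(α, β)` stays in `A` for a moment but leaves the half-plane
  have hcont : ContinuousAt (fun ε : ℝ => p + ε • (!₂[α, β] : Plane)) 0 := by fun_prop
  have hmem : ∀ᶠ ε in nhds (0 : ℝ), p + ε • (!₂[α, β] : Plane) ∈ interior A :=
    hcont.eventually_mem (by simpa using isOpen_interior.mem_nhds hpA)
  obtain ⟨ε, hε, hε0⟩ :=
    ((hmem.filter_mono nhdsWithin_le_nhds).and self_mem_nhdsWithin :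
      ∀ᶠ ε in nhdsWithin (0 : ℝ) (Set.Ioi 0), _ ∧ ε ∈ Set.Ioi (0 : ℝ)).exists
  have h1 := hA _ (interior_subset hε)
  have h2 := hB _ (interior_subset hpB)
  simp only [PiLp.add_apply, PiLp.smul_apply, smul_eq_mul] at h1
  simp at h1
  have h3 : 0 < α ^ 2 + β ^ 2 := by
    rcases h0 with h | h
    · positivity
    · positivity
  have h4 : 0 < ε * (α ^ 2 + β ^ 2) := mul_pos hε0 h3
  nlinarith

/-- Packings of pairwise separated regions combine, and their numbers of squares add up. -/
theorem packs_biUnion {ι : Type*} (S : Finset ι) {f : ι → Set Plane} {N : ι → ℕ} {A : Set Plane}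
    (hf : ∀ i ∈ S, Packs (f i) (N i)) (hA : ∀ i ∈ S, f i ⊆ A)
    (hs : ∀ i ∈ S, ∀ j ∈ S, i ≠ j → Separated (f i) (f j)) : Packs A (∑ i ∈ S, N i) := by
  classical
  choose! 𝒬 h𝒬 hN using hf
  have hdisj : ∀ i ∈ S, ∀ j ∈ S, i ≠ j → ∀ Q ∈ 𝒬 i, ∀ Q' ∈ 𝒬 j,
      Disjoint (interior Q) (interior Q') := fun i hi j hj hij Q hQ Q' hQ' =>
    (hs i hi j hj hij).disjoint_interior.mono (interior_mono ((h𝒬 i hi).1 Q hQ).2)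
      (interior_mono ((h𝒬 j hj).1 Q' hQ').2)
  refine ⟨S.biUnion 𝒬, ⟨fun Q hQ => ?_, ?_⟩, ?_⟩
  · obtain ⟨i, hi, hQi⟩ := Finset.mem_biUnion.1 hQ
    exact ⟨((h𝒬 i hi).1 Q hQi).1, ((h𝒬 i hi).1 Q hQi).2.trans (hA i hi)⟩
  · intro Q hQ Q' hQ' hne
    obtain ⟨i, hi, hQi⟩ := Finset.mem_biUnion.1 hQ
    obtain ⟨j, hj, hQj⟩ := Finset.mem_biUnion.1 hQ'
    by_cases hij : i = j
    · subst hij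
      exact (h𝒬 i hi).2 hQi hQj hne
    · exact hdisj i hi j hj hij Q hQi Q' hQj
  · rw [Finset.card_biUnion]
    · exact Finset.sum_congr rfl hN
    · intro i hi j hj hij
      refine Finset.disjoint_left.2 fun Q hQi hQj => ?_
      have := hdisj i hi j hj hij Q hQi Q hQj
      rw [disjoint_self] at this
      exact ((h𝒬 i hi).1 Q hQi).1.interior_nonempty.ne_empty this

theorem Packs.union {A B C : Set Plane} {M N : ℕ} (hM : Packs A M) (hN : Packs B N)
    (hs : Separated A B) (hA : A ⊆ C) (hB : B ⊆ C) : Packs C (M + N) := by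
  have := packs_biUnion (A := C) (Finset.univ : Finset Bool)
    (f := fun i => cond i A B) (N := fun i => cond i M N)
    (by simp [hM, hN]) (by simp [hA, hB]) (by simp [hs, hs.symm])
  simpa using this

theorem Packs.map {A B : Set Plane} {N : ℕ} (h : Packs A N) (f : Plane ≃ᵃⁱ[ℝ] Plane)
    (hf : ∀ p ∈ A, f p ∈ B) : Packs B N := by
  classical
  obtain ⟨𝒬, h𝒬, hN⟩ := h
  have hinj : Function.Injective (fun Q : Set Plane => f '' Q) := f.injective.image_injective
  refine ⟨𝒬.image (fun Q => f '' Q), ⟨?_, ?_⟩, by rw [Finset.card_image_of_injective _ hinj, hN]⟩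
  · intro Q hQ
    obtain ⟨Q, hQ', rfl⟩ := Finset.mem_image.1 hQ
    obtain ⟨⟨p, u, v, hu, hv, huv, rfl⟩, hsub⟩ := h𝒬.1 Q hQ'
    constructor
    · refine ⟨f p, f.linearIsometryEquiv u, f.linearIsometryEquiv v, by simpa, by simpa,
        by simpa, ?_⟩
      have hmap : ∀ s t : ℝ, f (p + s • u + t • v)
          = f p + s • f.linearIsometryEquiv u + t • f.linearIsometryEquiv v := by
        intro s t
        have := f.map_vadd p (s • u + t • v)
        simp only [vadd_eq_add, map_add, map_smul] at this
        rw [show p + s • u + t • v = s • u + t • v + p by abel, this]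
        abel
      ext q
      constructor
      · rintro ⟨_, ⟨s, hs, t, ht, rfl⟩, rfl⟩
        exact ⟨s, hs, t, ht, hmap s t⟩
      · rintro ⟨s, hs, t, ht, rfl⟩
        exact ⟨_, ⟨s, hs, t, ht, rfl⟩, hmap s t⟩
    · rintro _ ⟨q, hq, rfl⟩
      exact hf q (hsub hq)
  · intro Q hQ Q' hQ' hne
    obtain ⟨P, hP, rfl⟩ := Finset.mem_image.1 hQ
    obtain ⟨P', hP', rfl⟩ := Finset.mem_image.1 hQ'
    have hd : Disjoint (interior P) (interior P') := h𝒬.2 hP hP' (fun h => hne (by rw [h]))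
    have hi : ∀ T : Set Plane, interior (f '' T) = f '' interior T := fun T =>
      (f.toHomeomorph.image_interior T).symm
    change Disjoint (interior (f '' P)) (interior (f '' P'))
    rw [hi, hi]
    exact (Set.disjoint_image_iff f.injective).2 hd

/-! ### Tilted boxes, trapezoids and isometries -/

/-- The closed rectangle cut out by `a ≤ U ≤ b` and `a' ≤ V ≤ b'` in the coordinates
`U = c x + s y`, `V = -s x + c y`. When `c ^ 2 + s ^ 2 = 1` these coordinates are orthonormal, and
the edges of the rectangle have the directions `(c, s)` and `(-s, c)`. -/
def box (c s a b a' b' : ℝ) : Set Plane :=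
  {q | a ≤ c * q 0 + s * q 1 ∧ c * q 0 + s * q 1 ≤ b ∧
    a' ≤ -s * q 0 + c * q 1 ∧ -s * q 0 + c * q 1 ≤ b'}

section box

variable {c s a b a' b' : ℝ}

theorem isUnitSquare_box (h : c ^ 2 + s ^ 2 = 1) (a a' : ℝ) :
    IsUnitSquare (box c s a (a + 1) a' (a' + 1)) := by
  refine ⟨!₂[c * a - s * a', s * a + c * a'], !₂[c, s], !₂[-s, c], ?_, ?_, ?_, ?_⟩
  · simp [EuclideanSpace.norm_eq, h]
  · simp [EuclideanSpace.norm_eq, add_comm, h]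
  · simp [PiLp.inner_apply]; ring
  · ext q
    simp only [box, Set.mem_ofPred_eq, Set.mem_Icc]
    constructor
    · rintro ⟨h1, h2, h3, h4⟩
      refine ⟨c * q 0 + s * q 1 - a, ⟨by linarith, by linarith⟩,
        -s * q 0 + c * q 1 - a', ⟨by linarith, by linarith⟩, ?_⟩
      ext i
      fin_cases i
      · simp
        linear_combination (-q 0) * h
      · simp
        linear_combination (-q 1) * h
    · rintro ⟨σ, ⟨h1, h2⟩, τ, ⟨h3, h4⟩, rfl⟩
      simp only [PiLp.add_apply, PiLp.smul_apply, smul_eq_mul, Matrix.cons_val_zero,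
        Matrix.cons_val_one]
      have e1 : c * (c * a - s * a' + σ * c + τ * -s) + s * (s * a + c * a' + σ * s + τ * c)
        = a + σ := by linear_combination (a + σ) * h
      have e2 : -s * (c * a - s * a' + σ * c + τ * -s) + c * (s * a + c * a' + σ * s + τ * c)
        = a' + τ := by linear_combination (a' + τ) * h
      rw [e1, e2]
      exact ⟨by linarith, by linarith, by linarith, by linarith⟩

theorem box_subset {d d' e e' : ℝ} (h1 : d ≤ a) (h2 : b ≤ e) (h3 : d' ≤ a') (h4 : b' ≤ e') :
    box c s a b a' b' ⊆ box c s d e d' e' := fun _ h =>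
  ⟨h1.trans h.1, h.2.1.trans h2, h3.trans h.2.2.1, h.2.2.2.trans h4⟩

theorem separated_box_left (h : c ^ 2 + s ^ 2 = 1) {d d' e e' : ℝ} (hb : b ≤ d) :
    Separated (box c s a b a' b') (box c s d e d' e') := by
  refine ⟨c, s, b, ?_, fun p hp => hp.2.1, fun p hp => hb.trans hp.1⟩
  by_contra! h0
  simp [h0.1, h0.2] at h

theorem separated_box_below (h : c ^ 2 + s ^ 2 = 1) {d d' e e' : ℝ} (hb : b' ≤ d') :
    Separated (box c s a b a' b') (box c s d e d' e') := by
  refine ⟨-s, c, b', ?_, fun p hp => hp.2.2.2, fun p hp => hb.trans hp.2.2.1⟩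
  by_contra! h0
  simp at h0
  simp [h0.1, h0.2] at h

theorem packs_box_nat (h : c ^ 2 + s ^ 2 = 1) (a a' : ℝ) (m n : ℕ) :
    Packs (box c s a (a + m) a' (a' + n)) (m * n) := by
  have hrow : ∀ y : ℝ, Packs (box c s a (a + m) y (y + 1)) m := by
    intro y
    have := packs_biUnion (A := box c s a (a + m) y (y + 1)) (Finset.range m)
      (f := fun i => box c s (a + i) (a + i + 1) y (y + 1)) (N := fun _ => 1)
      (fun i _ => (isUnitSquare_box h _ _).packs) ?_ ?_
    · simpa using this
    · intro i hi
      have : (i : ℝ) + 1 ≤ m := by exact_mod_cast Finset.mem_range.1 hi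
      exact box_subset (by simp) (by linarith) le_rfl le_rfl
    · have key : ∀ i j : ℕ, i < j → Separated (box c s (a + i) (a + i + 1) y (y + 1))
          (box c s (a + j) (a + j + 1) y (y + 1)) := fun i j hij => by
        have : (i : ℝ) + 1 ≤ j := by exact_mod_cast hij
        exact separated_box_left h (by linarith)
      intro i _ j _ hij
      rcases lt_or_gt_of_ne hij with h | h
      · exact key i j h
      · exact (key j i h).symm
  have := packs_biUnion (A := box c s a (a + m) a' (a' + n)) (Finset.range n)
    (f := fun i => box c s a (a + m) (a' + i) (a' + i + 1)) (N := fun _ => m)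
    (fun i _ => hrow _) ?_ ?_
  · simpa [mul_comm] using this
  · intro i hi
    have : (i : ℝ) + 1 ≤ n := by exact_mod_cast Finset.mem_range.1 hi
    exact box_subset le_rfl le_rfl (by simp) (by linarith)
  · have key : ∀ i j : ℕ, i < j → Separated (box c s a (a + m) (a' + i) (a' + i + 1))
        (box c s a (a + m) (a' + j) (a' + j + 1)) := fun i j hij => by
      have : (i : ℝ) + 1 ≤ j := by exact_mod_cast hij
      exact separated_box_below h (by linarith)
    intro i _ j _ hij
    rcases lt_or_gt_of_ne hij with h | h
    · exact key i j h
    · exact (key j i h).symm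

/-- Recovering the Cartesian coordinates from the rotated ones. -/
theorem rotated_coords (h : c ^ 2 + s ^ 2 = 1) (x y : ℝ) :
    x = c * (c * x + s * y) - s * (-s * x + c * y) ∧
    y = s * (c * x + s * y) + c * (-s * x + c * y) :=
  ⟨by linear_combination (-x) * h, by linear_combination (-y) * h⟩

end box

theorem mem_box_one_zero {a b a' b' : ℝ} {q : Plane} :
    q ∈ box 1 0 a b a' b' ↔ a ≤ q 0 ∧ q 0 ≤ b ∧ a' ≤ q 1 ∧ q 1 ≤ b' := by
  simp [box]

/-- The trapezoid of height `h` and top edge `b`, described by the slope `t` of its right-hand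
side (the tangent of the angle to the vertical). -/
def slopeTrapezoid (h b t : ℝ) : Set Plane :=
  {p | 0 ≤ p 1 ∧ p 1 ≤ h ∧ 0 ≤ p 0 ∧ p 0 ≤ b + (h - p 1) * t}

theorem trapezoid_eq_slopeTrapezoid (h a θ : ℝ) :
    trapezoid h a θ = slopeTrapezoid h a (Real.tan θ) := rfl

theorem rectangle_eq_slopeTrapezoid (l w : ℝ) : rectangle l w = slopeTrapezoid w l 0 := by
  ext p
  simp only [rectangle, slopeTrapezoid, Set.mem_ofPred_eq]
  constructor
  · rintro ⟨h1, h2, h3, h4⟩; exact ⟨h3, h4, h1, by linarith⟩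
  · rintro ⟨h1, h2, h3, h4⟩; exact ⟨h3, by linarith, h1, h2⟩

theorem volume_slopeTrapezoid {h b t : ℝ} (hh : 0 ≤ h) (hb : 0 ≤ b) (ht : 0 ≤ t) :
    volume (slopeTrapezoid h b t) = ENNReal.ofReal (h * b + h ^ 2 * t / 2) := by
  let e := (EuclideanSpace.volume_preserving_symm_measurableEquiv_toLp (Fin 2))
  let S : Set (ℝ × ℝ) := {p | 0 ≤ p.2 ∧ p.2 ≤ h ∧ 0 ≤ p.1 ∧ p.1 ≤ b + (h - p.2) * t}
  have hS : MeasurableSet S := by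
    refine IsClosed.measurableSet ?_
    simp only [S, Set.ofPred_and]
    refine (isClosed_le (by fun_prop) (by fun_prop)).inter <|
      (isClosed_le (by fun_prop) (by fun_prop)).inter <|
      (isClosed_le (by fun_prop) (by fun_prop)).inter (isClosed_le (by fun_prop) (by fun_prop))
  have h1 : volume (slopeTrapezoid h b t) = volume S := by
    have e2 := (volume_preserving_finTwoArrow ℝ).comp e
    rw [← e2.measure_preimage hS.nullMeasurableSet]
    rfl
  rw [h1, Measure.volume_eq_prod, Measure.prod_apply_symm hS]
  have h2 : ∀ y : ℝ, volume ((fun x => (x, y)) ⁻¹' S)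
      = (Set.Icc 0 h).indicator (fun y => ENNReal.ofReal (b + (h - y) * t)) y := by
    intro y
    by_cases hy : y ∈ Set.Icc 0 h
    · rw [Set.indicator_of_mem hy]
      have : (fun x => (x, y)) ⁻¹' S = Set.Icc 0 (b + (h - y) * t) := by
        ext x
        simp [S, hy.1, hy.2]
      rw [this, Real.volume_Icc, sub_zero]
    · rw [Set.indicator_of_notMem hy]
      have : (fun x => (x, y)) ⁻¹' S = ∅ := by
        ext x
        simp only [Set.mem_preimage, Set.mem_ofPred_eq, S, Set.mem_empty_iff_false, iff_false]
        exact fun hx => hy ⟨hx.1, hx.2.1⟩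
      rw [this, measure_empty]
  simp_rw [h2]
  rw [lintegral_indicator measurableSet_Icc, ← ofReal_integral_eq_lintegral_ofReal]
  · congr 1
    rw [integral_Icc_eq_integral_Ioc, ← intervalIntegral.integral_of_le hh]
    have : ∀ y ∈ Set.uIcc 0 h, HasDerivAt (fun y => b * y + h * t * y - t * y ^ 2 / 2)
        (b + (h - y) * t) y := by
      intro y _
      have := (((hasDerivAt_id y).const_mul b).add ((hasDerivAt_id y).const_mul (h * t))).sub
        ((((hasDerivAt_id y).pow 2).const_mul t).div_const 2)
      refine this.congr_deriv ?_
      simp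
      ring
    rw [intervalIntegral.integral_eq_sub_of_hasDerivAt this
      (Continuous.intervalIntegrable (by fun_prop) _ _)]
    ring
  · exact (Continuous.integrableOn_Icc (by fun_prop))
  · refine (ae_restrict_iff' measurableSet_Icc).2 (Eventually.of_forall fun y hy => ?_)
    have := mul_nonneg (sub_nonneg.2 hy.2) ht
    simp only [Pi.zero_apply]
    linarith

theorem Packs.packingWaste_slopeTrapezoid_le {h b t : ℝ} (hh : 0 ≤ h) (hb : 0 ≤ b) (ht : 0 ≤ t)
    {N : ℕ} (hN : Packs (slopeTrapezoid h b t) N) :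
    packingWaste (slopeTrapezoid h b t) ≤ h * b + h ^ 2 * t / 2 - N := by
  have hv := volume_slopeTrapezoid hh hb ht
  refine (hN.packingWaste_le (by rw [hv]; exact ENNReal.ofReal_ne_top)).trans_eq ?_
  rw [Measure.real, hv, ENNReal.toReal_ofReal (by positivity)]

/-- Translation by `(x, y)`. -/
noncomputable def shift (x y : ℝ) : Plane ≃ᵃⁱ[ℝ] Plane :=
  AffineIsometryEquiv.constVAdd ℝ Plane (!₂[x, y] : Plane)

@[simp] theorem shift_apply_zero (x y : ℝ) (p : Plane) : shift x y p 0 = x + p 0 := by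
  simp [shift]

@[simp] theorem shift_apply_one (x y : ℝ) (p : Plane) : shift x y p 1 = y + p 1 := by
  simp [shift]

/-- Rotation by a half-turn about `(x / 2, y / 2)`. -/
noncomputable def halfTurn (x y : ℝ) : Plane ≃ᵃⁱ[ℝ] Plane :=
  (LinearIsometryEquiv.neg ℝ : Plane ≃ₗᵢ[ℝ] Plane).toAffineIsometryEquiv.trans (shift x y)

@[simp] theorem halfTurn_apply_zero (x y : ℝ) (p : Plane) : halfTurn x y p 0 = x - p 0 := by
  simp [halfTurn, sub_eq_add_neg]

@[simp] theorem halfTurn_apply_one (x y : ℝ) (p : Plane) : halfTurn x y p 1 = y - p 1 := by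
  simp [halfTurn, sub_eq_add_neg]

/-- Reflection in the diagonal. -/
noncomputable def swapCoords : Plane ≃ᵃⁱ[ℝ] Plane :=
  (LinearIsometryEquiv.piLpCongrLeft 2 ℝ ℝ (Equiv.swap (0 : Fin 2) 1)).toAffineIsometryEquiv

@[simp] theorem swapCoords_apply_zero (p : Plane) : swapCoords p 0 = p 1 := by
  simp [swapCoords]

@[simp] theorem swapCoords_apply_one (p : Plane) : swapCoords p 1 = p 0 := by
  simp [swapCoords]

/-! ### Packing a steep trapezoid by tilted rows -/

/-- A stack of `n` unit squares fits diagonally across a strip of width `b < n`: some direction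
`(c, s)` has `n c + s = b`. With `c = (1 - r²) / (1 + r²)` and `s = 2 r / (1 + r²)` this is a
quadratic equation for `r`, whose positive root is about `√((n - b) / (2 b))`. -/
theorem exists_tilt {n b ρ : ℝ} (hb : 0 < b) (hbn : b ≤ n)
    (hρ : 1 / b + √((n - b) / (2 * b)) ≤ ρ) (hρ1 : ρ < 1) :
    ∃ c s : ℝ, c ^ 2 + s ^ 2 = 1 ∧ n * c + s = b ∧ 0 < s ∧ s ≤ 2 * ρ ∧ c < 1 ∧
      1 - 2 * ρ ^ 2 ≤ c ∧ 0 < c ∧ s / c ≤ 2 * ρ / (1 - ρ ^ 2) := by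
  set d := n - b with hd
  have hd0 : 0 ≤ d := by linarith
  set w := √(1 + (n + b) * d) with hw
  have hnb : 0 < n + b := by linarith
  have hw2 : w ^ 2 = 1 + (n + b) * d := Real.sq_sqrt (by positivity)
  have hw0 : 0 ≤ w := Real.sqrt_nonneg _
  set r := (1 + w) / (n + b) with hr
  have hr0 : 0 < r := by positivity
  have hrn : r * (n + b) = 1 + w := div_mul_cancel₀ _ hnb.ne'
  have hquad : (n + b) * r ^ 2 = 2 * r + d := by
    have : (n + b) * ((n + b) * r ^ 2 - 2 * r - d) = 0 := by
      have : (r * (n + b) - 1) ^ 2 = w ^ 2 := by rw [hrn]; ring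
      rw [hw2] at this
      linear_combination this
    rcases mul_eq_zero.1 this with h | h
    · exact absurd h hnb.ne'
    · linarith
  have hrρ : r ≤ ρ := by
    refine le_trans ?_ hρ
    set e := √(d / (2 * b)) with he
    have he2 : e ^ 2 = d / (2 * b) := Real.sq_sqrt (by positivity)
    have he0 : 0 ≤ e := Real.sqrt_nonneg _
    have he3 : d = e ^ 2 * (2 * b) := by rw [he2]; field_simp
    rw [hr, div_le_iff₀ hnb]
    have h1 : (1 / b) * (n + b) ≥ 2 := by
      rw [ge_iff_le, div_mul_eq_mul_div, le_div_iff₀ hb]; linarith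
    have h2 : w ≤ 1 + e * (n + b) := by
      refine Real.sqrt_le_iff.2 ⟨by positivity, ?_⟩
      have : d ≤ e ^ 2 * (n + b) := by
        rw [he3]; exact mul_le_mul_of_nonneg_left (by linarith) (sq_nonneg e)
      have h3 := mul_le_mul_of_nonneg_left this hnb.le
      have h4 : 0 ≤ e * (n + b) := by positivity
      nlinarith
    nlinarith
  have hr1 : r < 1 := hrρ.trans_lt hρ1
  have hr2 : r ^ 2 ≤ ρ ^ 2 := by gcongr
  have hr21 : r ^ 2 < 1 := by nlinarith
  have hρ21 : ρ ^ 2 < 1 := by nlinarith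
  have hpos : (0 : ℝ) < 1 + r ^ 2 := by positivity
  refine ⟨(1 - r ^ 2) / (1 + r ^ 2), 2 * r / (1 + r ^ 2), ?_, ?_, by positivity, ?_, ?_, ?_,
    div_pos (by linarith) hpos, ?_⟩
  · field_simp; ring
  · field_simp
    linear_combination -hquad
  · rw [div_le_iff₀ hpos]; nlinarith
  · rw [div_lt_one hpos]; nlinarith
  · rw [le_div_iff₀ hpos]
    nlinarith [sq_nonneg r, sq_nonneg (r ^ 2), mul_nonneg (sq_nonneg ρ) (sq_nonneg r)]
  · rw [div_div_div_cancel_right₀ hpos.ne']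
    exact div_le_div₀ (by linarith) (by linarith) (by linarith) (by linarith)

/-- The packing of a trapezoid with nearly vertical right-hand side by tilted rows. All rows have
the direction `(c, s)`, and a row of `n` squares would fit exactly between two vertical lines at
distance `b`. The `i`-th row from the top drops its first `k i` squares, so that it starts at
`x = k i` and its right end moves outwards with the slanted side. Vertical columns fill the
staircase to the left of and below the rows and the triangle above them. -/
theorem packs_tilted_rows {h b t c s : ℝ} {B n R : ℕ} {k : ℕ → ℕ} (hB : (B : ℝ) ≤ b)
    (hn : n = B + 2) (hcs : c ^ 2 + s ^ 2 = 1) (hc : 0 < c) (hs : 0 < s)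
    (htilt : n * c + s = b) (ht : 0 ≤ t) (hRle : (R : ℝ) ≤ c * h - n * s) (hR1 : 1 ≤ R)
    (hkmono : Monotone k) (hk0 : k 0 = 0) (hkle : ∀ i, (k i : ℝ) * (1 - c) ≤ i * (t / c))
    (hkB : ∀ i, i < R → k i ≤ B) :
    Packs (slopeTrapezoid h b t) (∑ i ∈ Finset.range R, (n - k i) +
      (∑ j ∈ Finset.range B,
        ⌊(c * h - R - n * s + j * s + ((Finset.range R).filter fun i => j < k i).card) / c⌋₊
      + ∑ j ∈ Finset.range B, ⌊((n : ℝ) - 1 - j) * s / c⌋₊)) := by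
  have hnR : (n : ℝ) = B + 2 := by rw [hn]; push_cast; rfl
  have hc1 : c ≤ 1 := by nlinarith
  -- `K j` counts the rows that start to the right of the `j`-th column; they are the lowest ones
  set K : ℕ → ℕ := fun j => ((Finset.range R).filter fun i => j < k i).card with hK
  have hKle : ∀ i j, i < R → k i ≤ j → (K j : ℝ) ≤ R - 1 - i := by
    intro i j hi hij
    have hsub : ((Finset.range R).filter fun i => j < k i) ⊆ Finset.Ioo i R := by
      intro i' hi'
      simp only [Finset.mem_filter, Finset.mem_range, Finset.mem_Ioo] at hi' ⊢
      refine ⟨?_, hi'.1⟩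
      by_contra! hle
      exact absurd (hkmono hle) (by omega)
    have h1 := Finset.card_le_card hsub
    rw [Nat.card_Ioo] at h1
    have h2 : K j + 1 + i ≤ R := by change _ ≤ _ at h1; simp only [K]; omega
    have h3 : (K j : ℝ) + 1 + i ≤ R := by exact_mod_cast h2
    linarith
  -- the `i`-th row is `[u i, u i + n - k i] × [v i, v i + 1]` in rotated coordinates; its upper
  -- left corner has the abscissa `k i`
  set v : ℕ → ℝ := fun i => c * h - (i + 1) - n * s with hv
  set u : ℕ → ℝ := fun i => (k i + s * (v i + 1)) / c with hu
  have hv0 : ∀ i, i < R → 0 ≤ v i := by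
    intro i hi
    have : (i : ℝ) + 1 ≤ R := by exact_mod_cast hi
    simp only [hv]; linarith
  have hcu : ∀ i, c * u i = k i + s * (v i + 1) := fun i => mul_div_cancel₀ _ hc.ne'
  -- `L j` is the room below the lowest row that starts at or before `x = j`, and `M j` the room
  -- above the top row
  set L : ℕ → ℝ := fun j => (c * h - R - n * s + j * s + K j) / c with hL
  have hcL : ∀ j, c * L j = c * h - R - n * s + j * s + K j := fun j => mul_div_cancel₀ _ hc.ne'
  have hL0 : ∀ j, 0 ≤ L j := fun j => by
    have : 0 ≤ (j : ℝ) * s := by positivity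
    have : 0 ≤ (K j : ℝ) := Nat.cast_nonneg _
    exact div_nonneg (by linarith) hc.le
  set M : ℕ → ℝ := fun j => ((n : ℝ) - 1 - j) * s / c with hM
  have hcM : ∀ j, c * M j = ((n : ℝ) - 1 - j) * s := fun j => mul_div_cancel₀ _ hc.ne'
  have hjB : ∀ j, j < B → (j : ℝ) + 1 ≤ B := fun j hj => by exact_mod_cast hj
  have hM0 : ∀ j, j < B → 0 ≤ M j := fun j hj => by
    have := hjB j hj
    exact div_nonneg (mul_nonneg (by linarith) hs.le) hc.le
  have hLM : ∀ j, j < B → L j ≤ h - M j := by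
    intro j _
    have h1 := hKle 0 j hR1 (by rw [hk0]; exact Nat.zero_le _)
    have h2 : c * L j ≤ c * (h - M j) := by
      rw [hcL, mul_sub, hcM]; push_cast at h1; linarith
    exact le_of_mul_le_mul_left h2 hc
  have hmL : ∀ j, (⌊L j⌋₊ : ℝ) ≤ L j := fun j => Nat.floor_le (hL0 j)
  have hmM : ∀ j, j < B → (⌊M j⌋₊ : ℝ) ≤ M j := fun j hj => Nat.floor_le (hM0 j hj)
  set row : ℕ → Set Plane := fun i => box c s (u i) (u i + (n - k i : ℕ)) (v i) (v i + (1 : ℕ))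
    with hrow
  set low : ℕ → Set Plane := fun j => box 1 0 j (j + (1 : ℕ)) 0 (0 + (⌊L j⌋₊ : ℕ)) with hlow
  set upp : ℕ → Set Plane := fun j =>
    box 1 0 j (j + (1 : ℕ)) (h - ⌊M j⌋₊) (h - ⌊M j⌋₊ + (⌊M j⌋₊ : ℕ)) with hupp
  have h10 : (1 : ℝ) ^ 2 + 0 ^ 2 = 1 := by norm_num
  have hnk : ∀ i, i < R → ((n - k i : ℕ) : ℝ) = n - k i := fun i hi => by
    rw [Nat.cast_sub (by have := hkB i hi; omega)]
  have hrowX : ∀ i, i < R → ∀ q ∈ row i, (k i : ℝ) ≤ q 0 := by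
    intro i hi q hq
    have hx := (rotated_coords hcs (q 0) (q 1)).1
    obtain ⟨q1, q2, q3, q4⟩ := hq
    push_cast at q4
    have h1 := mul_le_mul_of_nonneg_left q1 hc.le
    have h2 := mul_le_mul_of_nonneg_left q4 hs.le
    rw [hcu] at h1
    linarith
  have hrow_sub : ∀ i, i < R → row i ⊆ slopeTrapezoid h b t := by
    intro i hi q hq
    have hX := hrowX i hi q hq
    obtain ⟨hx, hy⟩ := rotated_coords hcs (q 0) (q 1)
    obtain ⟨q1, q2, q3, q4⟩ := hq
    push_cast at q4
    rw [hnk i hi] at q2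
    have hki : (k i : ℝ) ≤ n := by
      have := hkB i hi
      exact_mod_cast (by omega : k i ≤ n)
    have hvi := hv0 i hi
    have hui : 0 ≤ u i := div_nonneg (by positivity) hc.le
    have hki0 : (0 : ℝ) ≤ k i := Nat.cast_nonneg _
    have hlow : 0 ≤ q 1 := by
      have h1 := mul_nonneg hs.le (hui.trans q1)
      have h2 := mul_nonneg hc.le (hvi.trans q3)
      linarith
    have hhigh : q 1 ≤ h - i / c := by
      have h1 := mul_le_mul_of_nonneg_left q2 hs.le
      have h2 := mul_le_mul_of_nonneg_left q4 hc.le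
      have h3 : c * (q 1) ≤ c * (h - i / c) := by
        have h4 : c * (h - i / c) = c * h - i := by field_simp
        have h5 : c * q 1 ≤ c * (s * (u i + (n - k i)) + c * (v i + 1)) := by
          refine mul_le_mul_of_nonneg_left ?_ hc.le
          linarith
        have h6 : c * (s * (u i + (n - k i)) + c * (v i + 1))
            = s * (k i) + (v i + 1) + c * s * (n - k i) := by
          linear_combination s * hcu i + (v i + 1) * hcs
        have h7 : c * s * (n - k i) ≤ s * (n - k i) := by
          have : 0 ≤ s * (n - k i) := mul_nonneg hs.le (by linarith)
          nlinarith
        have h8 : v i + 1 = c * h - i - n * s := by simp only [hv]; ring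
        rw [h4]
        linarith
      exact le_of_mul_le_mul_left h3 hc
    refine ⟨hlow, hhigh.trans (by have : 0 ≤ (i : ℝ) / c := by positivity
                                  linarith), hki0.trans hX, ?_⟩
    have h1 := mul_le_mul_of_nonneg_left q2 hc.le
    have h2 := mul_le_mul_of_nonneg_left q3 hs.le
    have h3 := hcu i
    have h4 : i * (t / c) ≤ (h - q 1) * t := by
      have : (i : ℝ) / c ≤ h - q 1 := by linarith
      calc (i : ℝ) * (t / c) = i / c * t := by ring
        _ ≤ _ := by gcongr
    have h5 := hkle i
    linarith
  have hlow_sub : ∀ j, j < B → low j ⊆ slopeTrapezoid h b t := by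
    intro j hj q hq
    obtain ⟨q1, q2, q3, q4⟩ := mem_box_one_zero.1 hq
    push_cast at q2
    have hj0 : (0 : ℝ) ≤ j := Nat.cast_nonneg _
    have hy : q 1 ≤ h := by
      have := hmL j; have := hLM j hj; have := hM0 j hj
      linarith
    have := mul_nonneg (sub_nonneg.2 hy) ht
    have := hjB j hj
    exact ⟨q3, hy, by linarith, by linarith⟩
  have hupp_sub : ∀ j, j < B → upp j ⊆ slopeTrapezoid h b t := by
    intro j hj q hq
    obtain ⟨q1, q2, q3, q4⟩ := mem_box_one_zero.1 hq
    push_cast at q2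
    have hj0 : (0 : ℝ) ≤ j := Nat.cast_nonneg _
    have hy : q 1 ≤ h := by linarith
    have := mul_nonneg (sub_nonneg.2 hy) ht
    have := hjB j hj
    have := hmM j hj; have := hLM j hj; have := hL0 j
    exact ⟨by linarith, hy, by linarith, by linarith⟩
  have hrr : ∀ i i', i < i' → Separated (row i') (row i) := by
    intro i i' hii
    refine separated_box_below hcs ?_
    have : (i : ℝ) + 1 ≤ i' := by exact_mod_cast hii
    simp only [hv]; push_cast; linarith
  have hcol : ∀ j j' : ℕ, j < j' → ∀ a a' d d' : ℝ,
      Separated (box 1 0 j (j + (1 : ℕ)) a a') (box 1 0 j' (j' + (1 : ℕ)) d d') := by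
    intro j j' hjj a a' d d'
    refine separated_box_left h10 ?_
    exact_mod_cast hjj
  have hcol' : ∀ j j' : ℕ, j ≠ j' → ∀ a a' d d' : ℝ,
      Separated (box 1 0 j (j + (1 : ℕ)) a a') (box 1 0 j' (j' + (1 : ℕ)) d d') := by
    intro j j' hjj a a' d d'
    rcases lt_or_gt_of_ne hjj with h | h
    · exact hcol j j' h _ _ _ _
    · exact (hcol j' j h _ _ _ _).symm
  have hlr : ∀ i j, i < R → j < B → Separated (low j) (row i) := by
    intro i j hi hj
    by_cases hkj : j < k i
    · refine ⟨1, 0, j + 1, by simp, fun p hp => ?_, fun p hp => ?_⟩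
      · have := (mem_box_one_zero.1 hp).2.1
        push_cast at this; linarith
      · have h1 := hrowX i hi p hp
        have h2 : (j : ℝ) + 1 ≤ k i := by exact_mod_cast hkj
        linarith
    · refine ⟨-s, c, v i, by simp [hc.ne'], fun p hp => ?_, fun p hp => hp.2.2.1⟩
      obtain ⟨q1, q2, q3, q4⟩ := mem_box_one_zero.1 hp
      have h1 := mul_le_mul_of_nonneg_left q1 hs.le
      have h2 := mul_le_mul_of_nonneg_left (q4.trans (by simpa using hmL j)) hc.le
      rw [hcL] at h2
      have h3 := hKle i j hi (by omega)
      simp only [hv]; linarith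
  have hru : ∀ i j, i < R → j < B → Separated (row i) (upp j) := by
    intro i j hi hj
    refine ⟨-s, c, c * h - n * s, by simp [hc.ne'], fun p hp => ?_, fun p hp => ?_⟩
    · have := hp.2.2.2
      simp only [hv] at this; push_cast at this
      have : (0 : ℝ) ≤ i := Nat.cast_nonneg _
      linarith
    · obtain ⟨q1, q2, q3, q4⟩ := mem_box_one_zero.1 hp
      push_cast at q2
      have h1 := mul_le_mul_of_nonneg_left q2 hs.le
      have h2 := mul_le_mul_of_nonneg_left q3 hc.le
      have h3 := mul_le_mul_of_nonneg_left (hmM j hj) hc.le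
      rw [hcM] at h3
      linarith
  have hlu : ∀ j j', j < B → j' < B → Separated (low j) (upp j') := by
    intro j j' hj hj'
    by_cases hjj : j = j'
    · subst hjj
      refine separated_box_below h10 ?_
      have := hmL j; have := hmM j hj; have := hLM j hj
      linarith
    · exact hcol' j j' hjj _ _ _ _
  have := packs_biUnion (A := slopeTrapezoid h b t)
    ((Finset.range R).disjSum ((Finset.range B).disjSum (Finset.range B)))
    (f := Sum.elim row (Sum.elim low upp))
    (N := Sum.elim (fun i => n - k i) (Sum.elim (fun j => ⌊L j⌋₊) (fun j => ⌊M j⌋₊)))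
    ?_ ?_ ?_
  · simpa [Finset.sum_disjSum] using this
  · rintro (i | j | j) hi
    · simpa [hrow] using packs_box_nat hcs (u i) (v i) (n - k i) 1
    · simpa [hlow] using packs_box_nat h10 (j : ℝ) 0 1 ⌊L j⌋₊
    · simpa [hupp] using packs_box_nat h10 (j : ℝ) (h - ⌊M j⌋₊) 1 ⌊M j⌋₊
  · rintro (i | j | j) hi
    · exact hrow_sub i (by simpa using hi)
    · exact hlow_sub j (by simpa using hi)
    · exact hupp_sub j (by simpa using hi)
  · rintro (i | j | j) hi (i' | j' | j') hi' hne
    all_goals simp only [Finset.inl_mem_disjSum, Finset.inr_mem_disjSum, Finset.mem_range] at hi hi'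
    · have : i ≠ i' := fun h => hne (by rw [h])
      rcases lt_or_gt_of_ne this with h | h
      · exact (hrr _ _ h).symm
      · exact hrr _ _ h
    · exact (hlr _ _ hi hi').symm
    · exact hru _ _ hi hi'
    · exact hlr _ _ hi' hi
    · exact hcol' j j' (fun h => hne (by rw [h])) _ _ _ _
    · exact hlu _ _ hi hi'
    · exact (hru _ _ hi' hi).symm
    · exact (hlu _ _ hi' hi).symm
    · exact hcol' j j' (fun h => hne (by rw [h])) _ _ _ _

theorem sum_range_cast (m : ℕ) : ∑ j ∈ Finset.range m, (j : ℝ) = m * (m - 1) / 2 := by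
  induction m with
  | zero => simp
  | succ m ih => rw [Finset.sum_range_succ, ih]; push_cast; ring

/-- Counting the pairs `(i, j)` with `j < k i` in two ways. -/
theorem sum_card_filter_lt {R B : ℕ} {k : ℕ → ℕ} (hkB : ∀ i, i < R → k i ≤ B) :
    ∑ j ∈ Finset.range B, (((Finset.range R).filter fun i => j < k i).card : ℝ)
      = ∑ i ∈ Finset.range R, (k i : ℝ) := by
  have h1 : ∀ j, (((Finset.range R).filter fun i => j < k i).card : ℝ)
      = ∑ i ∈ Finset.range R, if j < k i then (1 : ℝ) else 0 := by
    intro j; simp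
  simp_rw [h1]
  rw [Finset.sum_comm]
  refine Finset.sum_congr rfl fun i hi => ?_
  have h2 := hkB i (Finset.mem_range.1 hi)
  have h3 : (Finset.range B).filter (fun j => j < k i) = Finset.range (k i) := by
    ext j; simp; omega
  rw [Finset.sum_ite, h3]; simp

/-- The arithmetic behind the packing by tilted rows: `N₁` squares in `R` rows, which drop `S`
squares altogether, `N₂` squares in the columns below and `N₃` in the columns above them. Dropping
squares from the rows pays: `S` squares of the rows are replaced by columns of total height `S / c`,
and the gain `S / c - S` makes up for the triangle of area `h ^ 2 * t / 2`. -/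
theorem tilted_rows_estimate {h b t c s B n R S N₁ N₂ N₃ : ℝ} (hB' : b < B + 1)
    (hc : 0 < c) (hc1 : c < 1) (hs : 0 < s) (hn : n = B + 2) (htilt : n * c + s = b)
    (ht : 0 ≤ t) (hht : h * t ≤ 3 / 4) (hR0 : 0 ≤ R)
    (hRle : R ≤ c * h - n * s) (hRlt : c * h - n * s < R + 1) (hn0 : 0 ≤ n)
    (hN₁ : N₁ = n * R - S)
    (hN₂ : B * (h - R / c - n * s / c) + s / c * (B * (B - 1) / 2) + S / c - B ≤ N₂)
    (hN₃ : s / c * (B * (B + 3) / 2) - B ≤ N₃)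
    (hS : t / (c * (1 - c)) * (R * (R - 1) / 2) - R ≤ S) :
    h * b + h ^ 2 * t / 2 - (N₁ + (N₂ + N₃)) ≤
      2 * B + h * s + h * (1 - c) + (3 * (n * s) + 3) / c := by
  have h1c : 0 < 1 - c := by linarith
  have hns : 0 ≤ n * s := by positivity
  obtain ⟨P, hP⟩ : ∃ P : ℝ, P = R / c := ⟨_, rfl⟩
  have hPR : (R : ℝ) = c * P := by rw [hP]; field_simp
  obtain ⟨E, hE⟩ : ∃ E : ℝ, E = (n * s + 1) / c := ⟨_, rfl⟩
  have hcE : c * E = n * s + 1 := by rw [hE]; field_simp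
  have hP0 : 0 ≤ P := by rw [hP]; positivity
  have hPh : P ≤ h := by
    refine le_of_mul_le_mul_left ?_ hc
    rw [← hPR]; linarith
  have hPE : h - P ≤ E := by
    refine le_of_mul_le_mul_left ?_ hc
    rw [hcE, mul_sub, ← hPR]; linarith
  have hSle' : t * P * (P - 1 / c) / 2 - P * (1 - c) ≤ S / c - S := by
    have h1 : (1 - c) / c * (t / (c * (1 - c)) * (R * (R - 1) / 2) - R) ≤ (1 - c) / c * S := by
      gcongr
    have h2 : (1 - c) / c * (t / (c * (1 - c)) * (R * (R - 1) / 2) - R)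
        = t * P * (P - 1 / c) / 2 - P * (1 - c) := by
      rw [hPR]; field_simp
    have h3 : (1 - c) / c * S = S / c - S := by field_simp
    linarith
  have e1 : n * R + B * (h - R / c) = B * h + P * (b - s - B) := by
    rw [← hP, hPR]; linear_combination P * htilt
  have e2 : s / c * (B * (B - 1) / 2) + s / c * (B * (B + 3) / 2) - B * (n * s / c)
      = - (B * s / c) := by
    rw [hn]; ring
  have hE0 : 0 ≤ E := by linarith
  have hPt1 : t * P ≤ h * t := by rw [mul_comm h t]; gcongr
  have hPsq : h ^ 2 * t / 2 - t * P * P / 2 ≤ 3 / 4 * E := by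
    have h0 : 0 ≤ h + P := by linarith
    have h1 : (h - P) * (h + P) * t ≤ E * (h + P) * t := by gcongr
    have h2 : (h + P) * t ≤ 3 / 2 := by linarith
    have h3 : E * ((h + P) * t) ≤ E * (3 / 2) := by gcongr
    linarith
  have hbB : (b - B) * (h - P) ≤ E := by
    have h1 : (b - B) * (h - P) ≤ 1 * (h - P) :=
      mul_le_mul_of_nonneg_right (by linarith) (by linarith)
    linarith
  have hPt : t * P * (1 / c) / 2 ≤ 1 / c := by
    have h2 : t * P * (1 / c) ≤ 1 * (1 / c) :=
      mul_le_mul_of_nonneg_right (by linarith) (by positivity)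
    have h3 : 0 < 1 / c := by positivity
    linarith
  have hPs : P * s ≤ h * s := by gcongr
  have hPc : P * (1 - c) ≤ h * (1 - c) := by gcongr
  have hBs : B * s / c ≤ n * s / c := by
    gcongr; rw [hn]; linarith
  have hEn : (3 * (n * s) + 3) / c = 2 * E + n * s / c + 1 / c := by
    rw [hE]; ring
  rw [hEn]
  linarith

/-- The waste of the packing by tilted rows. The main terms are the rounding of the heights of
`2 B` columns and the two triangles of total area about `s` at the ends of each of at most
`h` rows. -/
theorem exists_packs_tilted_rows {h b t c s : ℝ} {B : ℕ} (hB : (B : ℝ) ≤ b) (hB' : b < B + 1)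
    (hB2 : 2 ≤ B) (hcs : c ^ 2 + s ^ 2 = 1) (hc : 0 < c) (hc1 : c < 1) (hs : 0 < s)
    (htilt : (B + 2) * c + s = b) (ht : 0 ≤ t) (hht : h * t ≤ 3 / 4)
    (hh : (B + 2) * s + 1 ≤ c * h) :
    ∃ N : ℕ, Packs (slopeTrapezoid h b t) N ∧
      h * b + h ^ 2 * t / 2 - N ≤
        2 * B + h * s + h * (1 - c) + (3 * ((B + 2) * s) + 3) / c := by
  obtain ⟨n, hn⟩ : ∃ n : ℕ, n = B + 2 := ⟨_, rfl⟩
  have hnR : (n : ℝ) = B + 2 := by rw [hn]; push_cast; rfl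
  rw [← hnR] at htilt hh ⊢
  have hn0 : (0 : ℝ) ≤ n := Nat.cast_nonneg _
  have hn4 : (4 : ℝ) ≤ n := by
    rw [hnR]; have : (2 : ℝ) ≤ B := by exact_mod_cast hB2
    linarith
  have hns : 0 ≤ n * s := by positivity
  have hh0 : 0 < h := by nlinarith
  set R : ℕ := ⌊c * h - n * s⌋₊ with hR
  have hR0 : 0 ≤ c * h - n * s := by linarith
  have hRle : (R : ℝ) ≤ c * h - n * s := Nat.floor_le hR0
  have hRlt : c * h - n * s < R + 1 := Nat.lt_floor_add_one _
  have hR1 : 1 ≤ R := Nat.le_floor (by push_cast; linarith)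
  -- dropping one square lengthens a row by `1 - c`, and the trapezoid widens by `t / c` from one
  -- row to the next
  set κ : ℝ := t / (c * (1 - c)) with hκ
  have h1c : 0 < 1 - c := by linarith
  have hκ0 : 0 ≤ κ := by positivity
  set k : ℕ → ℕ := fun i => ⌊i * κ⌋₊ with hk
  have hkmono : ∀ i i', i ≤ i' → k i ≤ k i' := fun i i' hi =>
    Nat.floor_le_floor (mul_le_mul_of_nonneg_right (by exact_mod_cast hi) hκ0)
  have hkle : ∀ i, (k i : ℝ) * (1 - c) ≤ i * (t / c) := by
    intro i
    have h1 : (k i : ℝ) ≤ i * κ := Nat.floor_le (by positivity)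
    calc (k i : ℝ) * (1 - c) ≤ i * κ * (1 - c) := by gcongr
      _ = i * (t / c) := by rw [hκ]; field_simp
  have hkB : ∀ i, i < R → k i ≤ B := by
    intro i hi
    have hi' : (i : ℝ) ≤ c * h := by
      have : (i : ℝ) < R := by exact_mod_cast hi
      linarith
    have h1 : (i : ℝ) * (t / c) ≤ 3 / 4 := by
      calc (i : ℝ) * (t / c) ≤ c * h * (t / c) := by gcongr
        _ = h * t := by field_simp
        _ ≤ 3 / 4 := hht
    have h2 : (k i : ℝ) * (1 - c) ≤ 3 / 4 := (hkle i).trans h1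
    have h3 : 1 < n * (1 - c) := by linarith
    have h4 : (k i : ℝ) < 3 / 4 * n := by
      by_contra! hcon
      have := mul_le_mul_of_nonneg_right hcon h1c.le
      linarith
    have h5 : (k i : ℝ) < B + 1 := by linarith
    have : k i < B + 1 := by exact_mod_cast h5
    omega
  have hnk : ∀ i, i < R → ((n - k i : ℕ) : ℝ) = n - k i := fun i hi => by
    rw [Nat.cast_sub (by have := hkB i hi; omega)]
  refine ⟨_, packs_tilted_rows hB hn hcs hc hs htilt ht hRle hR1 (fun i i' hi => hkmono i i' hi)
    (by simp [hk]) hkle hkB, ?_⟩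
  set K : ℕ → ℕ := fun j => ((Finset.range R).filter fun i => j < k i).card with hK
  set L : ℕ → ℝ := fun j => (c * h - R - n * s + j * s + K j) / c with hL
  set S := ∑ i ∈ Finset.range R, (k i : ℝ) with hS
  have hcount1 : ((∑ i ∈ Finset.range R, (n - k i) : ℕ) : ℝ) = n * R - S := by
    push_cast
    rw [Finset.sum_congr rfl fun i hi => hnk i (Finset.mem_range.1 hi), Finset.sum_sub_distrib]
    simp [hS, mul_comm]
  have hcount2 : B * (h - R / c - n * s / c) + s / c * (B * (B - 1) / 2) + S / c - B
      ≤ ((∑ j ∈ Finset.range B, ⌊L j⌋₊ : ℕ) : ℝ) := by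
    push_cast
    calc _ = ∑ j ∈ Finset.range B, (L j - 1) := by
          have : ∀ j : ℕ, L j - 1 = (h - R / c - n * s / c - 1) + s / c * j + (1 / c) * K j := by
            intro j; simp only [L]; field_simp; ring
          simp_rw [this]
          rw [Finset.sum_add_distrib, Finset.sum_add_distrib, ← Finset.mul_sum, ← Finset.mul_sum,
            sum_card_filter_lt hkB, sum_range_cast]
          simp
          ring
      _ ≤ _ := Finset.sum_le_sum fun j _ => by linarith [Nat.lt_floor_add_one (L j)]
  have hcount3 : s / c * (B * (B + 3) / 2) - B ≤
      ((∑ j ∈ Finset.range B, ⌊((n : ℝ) - 1 - j) * s / c⌋₊ : ℕ) : ℝ) := by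
    push_cast
    calc _ = ∑ j ∈ Finset.range B, (((n : ℝ) - 1 - j) * s / c - 1) := by
          have : ∀ j : ℕ, ((n : ℝ) - 1 - j) * s / c - 1 = (s / c * (n - 1) - 1) - s / c * j := by
            intro j; ring
          simp_rw [this]
          rw [Finset.sum_sub_distrib, ← Finset.mul_sum, sum_range_cast, hnR]
          simp
          ring
      _ ≤ _ := Finset.sum_le_sum fun j _ => by
          linarith [Nat.lt_floor_add_one (((n : ℝ) - 1 - j) * s / c)]
  have hSle : κ * (R * (R - 1) / 2) - R ≤ S := by
    calc _ = ∑ i ∈ Finset.range R, ((i : ℝ) * κ - 1) := by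
          rw [Finset.sum_sub_distrib, ← Finset.sum_mul, sum_range_cast]
          simp
          ring
      _ ≤ _ := Finset.sum_le_sum fun i _ => by linarith [Nat.lt_floor_add_one ((i : ℝ) * κ)]
  rw [Nat.cast_add, Nat.cast_add]
  exact tilted_rows_estimate hB' hc hc1 hs hnR htilt ht hht (Nat.cast_nonneg _) hRle hRlt hn0
    hcount1 hcount2 hcount3 hSle

/-! ### Trapezoids: aligned rows, slabs, tall trapezoids -/

/-- The waste of a steep trapezoid is of the order `b + h / √b`, since the tilt of the rows is about
`2 / √b`. -/
theorem exists_packs_steep_trapezoid {h b t : ℝ} (hb : 100 ≤ b) (ht : 0 ≤ t)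
    (hht : h * t ≤ 3 / 4) (hh : 3 * √b ≤ h) :
    ∃ N : ℕ, Packs (slopeTrapezoid h b t) N ∧
      h * b + h ^ 2 * t / 2 - N ≤ 2 * b + 5 / 2 * (h / √b) + 8 * √b := by
  obtain ⟨q, hq⟩ : ∃ q, q = √b := ⟨_, rfl⟩
  rw [← hq] at hh ⊢
  have hq10 : 10 ≤ q := by rw [hq]; exact Real.le_sqrt_of_sq_le (by norm_num; exact hb)
  have hqb : q ^ 2 = b := by rw [hq]; exact Real.sq_sqrt (by linarith)
  have hq0 : 0 < q := by linarith
  have hb0 : 0 < b := by linarith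
  set B := ⌊b⌋₊ with hBdef
  have hB : (B : ℝ) ≤ b := Nat.floor_le hb0.le
  have hB' : b < B + 1 := Nat.lt_floor_add_one b
  have hB2 : 2 ≤ B := Nat.le_floor (by norm_num; linarith)
  have hq1 : q * (1 / q) = 1 := by field_simp
  have hiq : 1 / q ≤ 1 / 10 := by gcongr
  have hiq0 : 0 < 1 / q := by positivity
  have hρ : 1 / b + √(((B : ℝ) + 2 - b) / (2 * b)) ≤ 11 / 10 * (1 / q) := by
    have h1 : √(((B : ℝ) + 2 - b) / (2 * b)) ≤ 1 / q := by
      refine Real.sqrt_le_iff.2 ⟨hiq0.le, ?_⟩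
      rw [div_pow, one_pow, hqb, div_le_div_iff₀ (by positivity) hb0]
      nlinarith
    have h2 : 1 / b = 1 / q * (1 / q) := by rw [← hqb]; field_simp
    nlinarith
  obtain ⟨c, s, hcs, htilt, hs, hsρ, hc1, hcρ, hc, -⟩ :=
    exists_tilt (n := B + 2) hb0 (by linarith) hρ (by linarith)
  have h1c : 1 - c ≤ 1 / 4 * (1 / q) := by nlinarith
  have hc97 : 97 / 100 ≤ c := by linarith
  have hns : ((B : ℝ) + 2) * s ≤ 9 / 4 * q := by
    have h1 : ((B : ℝ) + 2) * s ≤ (q ^ 2 + 2) * (11 / 5 * (1 / q)) := by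
      gcongr
      · linarith
      · linarith
    have h2 : (q ^ 2 + 2) * (11 / 5 * (1 / q)) = 11 / 5 * q + 22 / 5 * (1 / q) := by
      field_simp; ring
    linarith
  have hh0 : 0 ≤ h := by linarith
  obtain ⟨N, hN, hle⟩ := exists_packs_tilted_rows hB hB' hB2 hcs hc hc1 hs htilt ht hht
    (by nlinarith)
  refine ⟨N, hN, hle.trans ?_⟩
  have e1 : h * s ≤ h * (11 / 5 * (1 / q)) := by gcongr; linarith
  have e2 : h * (1 - c) ≤ h * (1 / 4 * (1 / q)) := by gcongr
  have e3 : (3 * (((B : ℝ) + 2) * s) + 3) / c ≤ 8 * q := by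
    rw [div_le_iff₀ hc]; nlinarith
  have e4 : 5 / 2 * (h / q) = 5 / 2 * (h * (1 / q)) := by field_simp
  have e5 : 0 ≤ h * (1 / q) := by positivity
  rw [e4]
  linarith

/-- Packing a trapezoid by horizontal rows that start at the vertical side. -/
theorem exists_packs_aligned_rows {h b t : ℝ} (hh : 0 ≤ h) (hb : 0 ≤ b) (ht : 0 ≤ t) :
    ∃ N : ℕ, Packs (slopeTrapezoid h b t) N ∧
      h * b + h ^ 2 * t / 2 - N ≤ b + h + t * (h + 1) / 2 := by
  have h10 : (1 : ℝ) ^ 2 + 0 ^ 2 = 1 := by norm_num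
  set R := ⌊h⌋₊ with hR
  have hRh : (R : ℝ) ≤ h := Nat.floor_le hh
  have hhR : h < R + 1 := Nat.lt_floor_add_one h
  set w : ℕ → ℝ := fun i => b + (h - i - 1) * t with hw
  have hiR : ∀ i, i < R → (i : ℝ) + 1 ≤ R := fun i hi => by exact_mod_cast hi
  have hw0 : ∀ i, i < R → 0 ≤ w i := fun i hi => by
    have := hiR i hi
    have := mul_nonneg (by linarith : 0 ≤ h - i - 1) ht
    simp only [hw]; linarith
  refine ⟨∑ i ∈ Finset.range R, ⌊w i⌋₊, ?_, ?_⟩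
  · refine packs_biUnion _ (f := fun i : ℕ => box 1 0 0 (0 + ⌊w i⌋₊) i (i + (1 : ℕ))) ?_ ?_ ?_
    · intro i _
      simpa using packs_box_nat h10 0 (i : ℝ) ⌊w i⌋₊ 1
    · intro i hi q hq
      obtain ⟨q1, q2, q3, q4⟩ := mem_box_one_zero.1 hq
      push_cast at q4
      have hi := Finset.mem_range.1 hi
      have h1 := hiR i hi
      have h2 := Nat.floor_le (hw0 i hi)
      have h3 : (h - i - 1) * t ≤ (h - q 1) * t := by gcongr ?_ * t; linarith
      have h4 : w i = b + (h - i - 1) * t := rfl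
      have h5 : (0 : ℝ) ≤ i := Nat.cast_nonneg i
      exact ⟨by linarith, by linarith, q1, by linarith⟩
    · have key : ∀ i j : ℕ, i < j → ∀ a a' : ℝ,
          Separated (box 1 0 0 a i (i + (1 : ℕ))) (box 1 0 0 a' j (j + (1 : ℕ))) := by
        intro i j hij a a'
        exact separated_box_below h10 (by exact_mod_cast hij)
      intro i _ j _ hij
      rcases lt_or_gt_of_ne hij with h | h
      · exact key i j h _ _
      · exact (key j i h _ _).symm
  · push_cast
    have h1 : ∑ i ∈ Finset.range R, (w i - 1) ≤ ∑ i ∈ Finset.range R, (⌊w i⌋₊ : ℝ) :=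
      Finset.sum_le_sum fun i _ => by linarith [Nat.lt_floor_add_one (w i)]
    have h2 : ∑ i ∈ Finset.range R, (w i - 1)
        = R * (b + (h - 1) * t - 1) - t * (R * (R - 1) / 2) := by
      have : ∀ i : ℕ, w i - 1 = (b + (h - 1) * t - 1) - t * i := by
        intro i; simp only [hw]; ring
      simp_rw [this]
      rw [Finset.sum_sub_distrib, ← Finset.mul_sum, sum_range_cast]
      simp
      ring
    have h3 : (h - R) * b ≤ 1 * b := by gcongr; linarith
    have h4 : t * (h - R) ^ 2 ≤ t * 1 := by
      gcongr; nlinarith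
    nlinarith

/-- A horizontal slab of integer height, cut into a rectangle with integer sides and a steep
trapezoid whose top edge is between `w` and `w + 1`. -/
theorem exists_packs_slab {b t w : ℝ} {H : ℕ} (hw : 100 ≤ w) (hwb : w ≤ b) (ht : 0 ≤ t)
    (hHt : H * t ≤ 3 / 4) (hH : 3 * √(w + 1) ≤ H) :
    ∃ N : ℕ, Packs (slopeTrapezoid H b t) N ∧
      H * b + (H : ℝ) ^ 2 * t / 2 - N ≤ 2 * (w + 1) + 5 / 2 * (H / √w) + 8 * √(w + 1) := by
  have h10 : (1 : ℝ) ^ 2 + 0 ^ 2 = 1 := by norm_num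
  set g := ⌊b - w⌋₊ with hg
  have hgb : (g : ℝ) ≤ b - w := Nat.floor_le (by linarith)
  have hbg : b - w < g + 1 := Nat.lt_floor_add_one _
  have hsq : √(b - g) ≤ √(w + 1) := Real.sqrt_le_sqrt (by linarith)
  have hsq' : √w ≤ √(b - g) := Real.sqrt_le_sqrt (by linarith)
  have hw0 : 0 < √w := Real.sqrt_pos.2 (by linarith)
  obtain ⟨N, hN, hle⟩ := exists_packs_steep_trapezoid (h := H) (b := b - g) (by linarith) ht hHt
    (by linarith)
  have hN' : Packs (slopeTrapezoid H b t ∩ {p | (g : ℝ) ≤ p 0}) N := by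
    refine hN.map (shift g 0) fun p hp => ?_
    obtain ⟨h1, h2, h3, h4⟩ := hp
    refine ⟨⟨?_, ?_, ?_, ?_⟩, ?_⟩
    · simpa using h1
    · simpa using h2
    · rw [shift_apply_zero]; positivity
    · rw [shift_apply_zero, shift_apply_one]; linarith
    · simpa using h3
  refine ⟨g * H + N, (packs_box_nat h10 0 0 g H).union hN' ⟨1, 0, g, by simp, ?_, ?_⟩ ?_
    Set.inter_subset_left, ?_⟩
  · intro p hp
    have := (mem_box_one_zero.1 hp).2.1
    linarith
  · intro p hp
    have : (g : ℝ) ≤ p 0 := hp.2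
    linarith
  · intro p hp
    obtain ⟨h1, h2, h3, h4⟩ := mem_box_one_zero.1 hp
    have h5 : p 1 ≤ H := by linarith
    have := mul_nonneg (sub_nonneg.2 h5) ht
    exact ⟨h3, h5, h1, by linarith⟩
  · have h1 : (H : ℝ) / √(b - g) ≤ H / √w := by gcongr
    push_cast
    linarith

/-- Cutting a trapezoid into `M` slabs of height `H` and a rest at the bottom. -/
theorem packs_slopeTrapezoid_of_slabs {X b t H : ℝ} {M : ℕ} {N : ℕ → ℕ} {N' : ℕ}
    (hH : 0 ≤ H) (hMX : M * H ≤ X)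
    (hN : ∀ i, i < M → Packs (slopeTrapezoid H (b + i * H * t) t) (N i))
    (hN' : Packs (slopeTrapezoid (X - M * H) (b + M * H * t) t) N') :
    Packs (slopeTrapezoid X b t) (∑ i ∈ Finset.range M, N i + N') := by
  set T := slopeTrapezoid X b t with hT
  have hslab : ∀ i, i < M →
      Packs (T ∩ {p | X - (i + 1) * H ≤ p 1 ∧ p 1 ≤ X - i * H}) (N i) := by
    intro i hi
    refine (hN i hi).map (shift 0 (X - (i + 1) * H)) fun p hp => ?_
    obtain ⟨h1, h2, h3, h4⟩ := hp
    have hiM : ((i : ℝ) + 1) * H ≤ M * H := by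
      gcongr; exact_mod_cast hi
    have hi0 : 0 ≤ (i : ℝ) * H := by positivity
    refine ⟨⟨?_, ?_, ?_, ?_⟩, ?_, ?_⟩ <;>
      simp only [shift_apply_zero, shift_apply_one] <;> linarith
  have hupper : Packs (T ∩ {p | X - M * H ≤ p 1}) (∑ i ∈ Finset.range M, N i) := by
    refine packs_biUnion _ (fun i hi => hslab i (Finset.mem_range.1 hi)) ?_ ?_
    · intro i hi p hp
      have hiM : ((i : ℝ) + 1) * H ≤ M * H := by
        gcongr; exact_mod_cast Finset.mem_range.1 hi
      refine ⟨hp.1, ?_⟩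
      have := hp.2.1
      simp only [Set.mem_ofPred_eq]
      linarith
    · have key : ∀ i j : ℕ, i < j → Separated
          (T ∩ {p | X - ((j : ℝ) + 1) * H ≤ p 1 ∧ p 1 ≤ X - j * H})
          (T ∩ {p | X - ((i : ℝ) + 1) * H ≤ p 1 ∧ p 1 ≤ X - i * H}) := by
        intro i j hij
        have : ((i : ℝ) + 1) * H ≤ j * H := by gcongr; exact_mod_cast hij
        refine ⟨0, 1, X - j * H, by simp, fun p hp => ?_, fun p hp => ?_⟩
        · have := hp.2.2; linarith
        · have := hp.2.1; linarith
      intro i _ j _ hij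
      rcases lt_or_gt_of_ne hij with h | h
      · exact (key i j h).symm
      · exact key j i h
  have hlower : slopeTrapezoid (X - M * H) (b + M * H * t) t ⊆ T := by
    intro p hp
    obtain ⟨h1, h2, h3, h4⟩ := hp
    have : 0 ≤ (M : ℝ) * H := by positivity
    exact ⟨h1, by linarith, h3, by linarith⟩
  refine hupper.union hN' ⟨0, -1, -(X - M * H), by simp, fun p hp => ?_, fun p hp => ?_⟩
    Set.inter_subset_left hlower
  · have : X - M * H ≤ p 1 := hp.2
    linarith
  · have := hp.2.1
    linarith

/-- A trapezoid of height `z ^ 6`, cut into about `2 z ^ 3` slabs of height about `z ^ 3 / 2`. Each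
slab ends in a steep trapezoid with top edge about `z ^ 2` and wastes at most
about `13 / 4 * z ^ 2`. -/
theorem exists_packs_tall_trapezoid {z b t : ℝ} (hz : 16 ≤ z) (hb : z ^ 2 ≤ b)
    (hb' : b ≤ 4 * z ^ 3) (ht : 0 ≤ t) (ht' : t * z ^ 3 ≤ 3 / 2) :
    ∃ N : ℕ, Packs (slopeTrapezoid (z ^ 6) b t) N ∧
      z ^ 6 * b + (z ^ 6) ^ 2 * t / 2 - N ≤ 8 * z ^ 5 := by
  have hz0 : 0 < z := by linarith
  have hz2 : 16 ^ 2 ≤ z ^ 2 := by gcongr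
  have hz3 : 16 ^ 3 ≤ z ^ 3 := by gcongr
  set H := ⌊z ^ 3 / 2⌋₊ with hHdef
  have hH : (H : ℝ) ≤ z ^ 3 / 2 := Nat.floor_le (by positivity)
  have hH' : z ^ 3 / 2 < H + 1 := Nat.lt_floor_add_one _
  have hH0 : (0 : ℝ) < H := by linarith
  have hHt : H * t ≤ 3 / 4 := by
    have : (H : ℝ) * t ≤ z ^ 3 / 2 * t := by gcongr
    linarith
  set M := ⌊z ^ 6 / H⌋₊ with hMdef
  have hM : (M : ℝ) * H ≤ z ^ 6 := by
    rw [← le_div_iff₀ hH0]; exact Nat.floor_le (by positivity)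
  have hM' : z ^ 6 < (M + 1) * H := by
    rw [← div_lt_iff₀ hH0]; exact Nat.lt_floor_add_one _
  have hMle : (M : ℝ) ≤ 2.001 * z ^ 3 := by
    refine le_of_mul_le_mul_right (hM.trans ?_) hH0
    have h6 : z ^ 6 = z ^ 3 * z ^ 3 := by ring
    rw [h6]
    nlinarith
  have hsq : √(z ^ 2) = z := Real.sqrt_sq hz0.le
  have hsq1 : √(z ^ 2 + 1) ≤ z + 1 / 10 := by
    refine Real.sqrt_le_iff.2 ⟨by linarith, by nlinarith⟩
  have hz3' : z ^ 3 ≥ 256 * z := by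
    have : z ^ 3 = z ^ 2 * z := by ring
    rw [this]; nlinarith
  have hMHt : 0 ≤ (M : ℝ) * H * t := by positivity
  have hslab : ∀ i : ℕ, ∃ N : ℕ, Packs (slopeTrapezoid H (b + i * H * t) t) N ∧
      H * (b + i * H * t) + (H : ℝ) ^ 2 * t / 2 - N ≤
        2 * (z ^ 2 + 1) + 5 / 2 * (H / z) + 8 * (z + 1 / 10) := by
    intro i
    have hi : 0 ≤ (i : ℝ) * H * t := by positivity
    obtain ⟨N, hN, hle⟩ := exists_packs_slab (b := b + i * H * t) (w := z ^ 2) (t := t) (H := H)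
      (by linarith) (by linarith) ht hHt (by linarith)
    rw [hsq] at hle
    exact ⟨N, hN, by linarith⟩
  choose N hN hle using hslab
  obtain ⟨N', hN', hle'⟩ := exists_packs_aligned_rows (h := z ^ 6 - M * H)
    (b := b + M * H * t) (t := t) (by linarith) (by nlinarith) ht
  refine ⟨_, packs_slopeTrapezoid_of_slabs hH0.le hM (fun i _ => hN i) hN', ?_⟩
  have hHz : (H : ℝ) / z ≤ z ^ 2 / 2 := by
    rw [div_le_iff₀ hz0]; linarith
  have hsum : ∑ i ∈ Finset.range M, (H * (b + i * H * t) + (H : ℝ) ^ 2 * t / 2 - N i)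
      ≤ M * (13 / 4 * z ^ 2 + 8 * z + 3) := by
    calc _ ≤ ∑ i ∈ Finset.range M, (13 / 4 * z ^ 2 + 8 * z + 3) :=
          Finset.sum_le_sum fun i _ => (hle i).trans (by linarith)
      _ = _ := by simp; ring
  have hsum' : ∑ i ∈ Finset.range M, (H * (b + i * H * t) + (H : ℝ) ^ 2 * t / 2 - N i)
      = M * H * b + (M * H) ^ 2 * t / 2 - ∑ i ∈ Finset.range M, (N i : ℝ) := by
    have : ∀ i : ℕ, H * (b + i * H * t) + (H : ℝ) ^ 2 * t / 2 - N i
        = H * b + (H : ℝ) ^ 2 * t / 2 + H * H * t * i - N i := fun i => by ring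
    simp_rw [this]
    rw [Finset.sum_sub_distrib, Finset.sum_add_distrib, ← Finset.mul_sum, sum_range_cast]
    simp
    ring
  rw [hsum'] at hsum
  have hM0 : (0 : ℝ) ≤ M := Nat.cast_nonneg _
  have h1 : M * (13 / 4 * z ^ 2 + 8 * z + 3) ≤ 2.001 * z ^ 3 * (13 / 4 * z ^ 2 + 8 * z + 3) := by
    gcongr
  have hrest : z ^ 6 - M * H ≤ z ^ 3 / 2 := by linarith
  have h2 : M * H * t ≤ 3 / 2 * z ^ 3 := by
    calc M * H * t ≤ z ^ 6 * t := by gcongr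
      _ = t * z ^ 3 * z ^ 3 := by ring
      _ ≤ _ := by gcongr
  have h3 : t * (z ^ 6 - M * H + 1) ≤ 3 / 2 := by
    calc t * (z ^ 6 - M * H + 1) ≤ t * z ^ 3 := by gcongr; linarith
      _ ≤ _ := ht'
  have h4 : z ^ 4 * 16 ≤ z ^ 5 := by
    have : z ^ 5 = z ^ 4 * z := by ring
    rw [this]; gcongr
  have h5 : z ^ 3 * 256 ≤ z ^ 5 := by
    have : z ^ 5 = z ^ 3 * z ^ 2 := by ring
    rw [this]; gcongr; linarith
  push_cast
  linarith

/-! ### Rectangles from tilted strips -/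

/-- Tilted columns of `m` squares that span a strip of width `Y`, completed by a trapezoid at
either end. The trapezoids have top edges `b` and `b'` and the same slope `s / c`. -/
theorem packs_strip_of_ends {l Y b b' c s : ℝ} {m K N N' : ℕ} (hcs : c ^ 2 + s ^ 2 = 1)
    (hc : 0 < c) (hs : 0 < s) (hm : m * c + s = Y) (hb : 0 ≤ b) (hb' : 0 ≤ b')
    (hl : l = b + b' + Y * (s / c) + K / c)
    (hN : Packs (slopeTrapezoid Y b (s / c)) N) (hN' : Packs (slopeTrapezoid Y b' (s / c)) N') :
    Packs (rectangle l Y) (N + K * m + N') := by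
  set t := s / c with ht
  have hct : c * t = s := by rw [ht]; field_simp
  have ht0 : 0 ≤ t := by positivity
  have hY0 : 0 ≤ Y := by rw [← hm]; positivity
  have hYt : 0 ≤ Y * t := by positivity
  have hKc : 0 ≤ K / c := by positivity
  have hcl : c * l = c * b + c * b' + s * Y + K := by
    rw [hl]; field_simp; linear_combination Y * hct
  obtain ⟨σ, hσ⟩ : ∃ σ, σ = c * b + s * Y := ⟨_, rfl⟩
  have hσ0 : 0 ≤ σ := by rw [hσ]; positivity
  have hleft : Packs (rectangle l Y ∩ {p | c * p 0 + s * p 1 ≤ σ}) N := by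
    refine hN.mono fun p hp => ?_
    obtain ⟨h1, h2, h3, h4⟩ := hp
    have h5 : (Y - p 1) * t ≤ Y * t := by gcongr; linarith
    refine ⟨⟨h3, by linarith, h1, h2⟩, ?_⟩
    have h6 := mul_le_mul_of_nonneg_left h4 hc.le
    simp only [Set.mem_ofPred_eq]
    rw [hσ]
    linear_combination h6 + (Y - p 1) * hct
  have hright : Packs (rectangle l Y ∩ {p | σ + K ≤ c * p 0 + s * p 1}) N' := by
    refine hN'.map (halfTurn l Y) fun p hp => ?_
    obtain ⟨h1, h2, h3, h4⟩ := hp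
    have h5 : (Y - p 1) * t ≤ Y * t := by gcongr; linarith
    have h6 := mul_le_mul_of_nonneg_left h4 hc.le
    refine ⟨⟨?_, ?_, ?_, ?_⟩, ?_⟩ <;>
      simp only [Set.mem_ofPred_eq, halfTurn_apply_zero, halfTurn_apply_one] <;> try linarith
    rw [hσ]
    linear_combination h6 + (Y - p 1) * hct - hcl
  have hmid : Packs (rectangle l Y ∩ {p | σ ≤ c * p 0 + s * p 1 ∧ c * p 0 + s * p 1 ≤ σ + K})
      (K * m) := by
    have := packs_biUnion
      (A := rectangle l Y ∩ {p | σ ≤ c * p 0 + s * p 1 ∧ c * p 0 + s * p 1 ≤ σ + K})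
      (Finset.range K)
      (f := fun i : ℕ => box c s (σ + i) (σ + i + (1 : ℕ)) (-s * (σ + i) / c)
        (-s * (σ + i) / c + m)) (N := fun _ => m) ?_ ?_ ?_
    · simpa using this
    · intro i _
      simpa using packs_box_nat hcs (σ + i) (-s * (σ + i) / c) 1 m
    · intro i hi p hp
      have hiK : (i : ℝ) + 1 ≤ K := by exact_mod_cast Finset.mem_range.1 hi
      have hi0 : (0 : ℝ) ≤ i := Nat.cast_nonneg i
      obtain ⟨hx, hy⟩ := rotated_coords hcs (p 0) (p 1)
      obtain ⟨h1, h2, h3, h4⟩ := hp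
      push_cast at h2
      obtain ⟨e, he⟩ : ∃ e, e = -s * (σ + i) / c := ⟨_, rfl⟩
      have hce : c * e = -s * (σ + i) := by rw [he]; field_simp
      rw [← he] at h3 h4
      have k1 := mul_le_mul_of_nonneg_left h1 hc.le
      have k2 := mul_le_mul_of_nonneg_left h2 hc.le
      have k3 := mul_le_mul_of_nonneg_left h3 hs.le
      have k4 := mul_le_mul_of_nonneg_left h4 hs.le
      have k5 := mul_le_mul_of_nonneg_left h1 hs.le
      have k6 := mul_le_mul_of_nonneg_left h2 hs.le
      have k7 := mul_le_mul_of_nonneg_left h3 hc.le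
      have k8 := mul_le_mul_of_nonneg_left h4 hc.le
      have hsq : s ^ 2 ≤ 1 := by nlinarith
      refine ⟨⟨?_, ?_, ?_, ?_⟩, ?_, ?_⟩
      · -- the leftmost point of the column is its upper left corner
        have h5 : 0 ≤ c * (c * (σ + i) - s * (e + m)) := by
          have : c * (c * (σ + i) - s * (e + m)) = c * b + s ^ 2 + i := by
            rw [hσ] at hce ⊢
            linear_combination (-s) * hce - s * hm + (c * b + s * Y + i) * hcs
          rw [this]; positivity
        have h6 := nonneg_of_mul_nonneg_right h5 hc
        linarith
      · have h5 : c * (c * (σ + i + 1) - s * e) ≤ c * l := by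
          have : c * (c * (σ + i + 1) - s * e) = c * b + s * Y + i + c ^ 2 := by
            rw [hσ] at hce ⊢
            linear_combination (-s) * hce + (c * b + s * Y + i) * hcs
          rw [this, hcl]
          nlinarith [mul_nonneg hc.le hb']
        have h6 := le_of_mul_le_mul_left h5 hc
        linarith
      · linarith
      · linarith
      · linarith
      · simp only []; linarith
    · have key : ∀ i j : ℕ, i < j → ∀ a a' d d' : ℝ,
          Separated (box c s (σ + i) (σ + i + (1 : ℕ)) a a')
            (box c s (σ + j) (σ + j + (1 : ℕ)) d d') := by
        intro i j hij a a' d d'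
        have : (i : ℝ) + 1 ≤ j := by exact_mod_cast hij
        exact separated_box_left hcs (by push_cast; linarith)
      intro i _ j _ hij
      rcases lt_or_gt_of_ne hij with h | h
      · exact key i j h _ _ _ _
      · exact (key j i h _ _ _ _).symm
  have hK0 : (0 : ℝ) ≤ K := Nat.cast_nonneg _
  have h1 : Packs (rectangle l Y ∩ {p | c * p 0 + s * p 1 ≤ σ + K}) (N + K * m) := by
    refine hleft.union hmid ⟨c, s, σ, by simp [hc.ne'], fun p hp => hp.2, fun p hp => hp.2.1⟩
      (fun p hp => ⟨hp.1, ?_⟩) (fun p hp => ⟨hp.1, hp.2.2⟩)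
    have : c * p 0 + s * p 1 ≤ σ := hp.2
    simp only [Set.mem_ofPred_eq]
    linarith
  exact h1.union hright ⟨c, s, σ + K, by simp [hc.ne'], fun p hp => hp.2, fun p hp => hp.2⟩
    Set.inter_subset_left Set.inter_subset_left

/-- A rectangle of length `l` and width `Y`, packed by tilted columns, wastes about `τ` for each
unit of length, where `τ ≈ √(2 / Y)` bounds the tangent of the tilt, and the waste of two end
trapezoids, bounded by `E`. -/
theorem exists_packs_strip {l Y b₀ τ ρ E : ℝ} (hY : 1 ≤ Y) (hb₀ : 0 ≤ b₀)
    (hρ : 1 / Y + √(1 / (2 * Y)) ≤ ρ) (hρ1 : ρ ≤ 1 / 2) (hτ : 2 * ρ / (1 - ρ ^ 2) ≤ τ)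
    (hl : 2 * b₀ + Y * τ ≤ l)
    (hE : ∀ b t, b₀ ≤ b → b ≤ b₀ + 2 → 0 ≤ t → t ≤ τ → ∃ N : ℕ, Packs (slopeTrapezoid Y b t) N ∧
      Y * b + Y ^ 2 * t / 2 - N ≤ E) :
    ∃ N : ℕ, Packs (rectangle l Y) N ∧ l * Y - N ≤ l * τ + 2 * E := by
  have hY0 : 0 < Y := by linarith
  set m := ⌊Y⌋₊ + 1 with hm
  have hmY : Y < m := by rw [hm]; push_cast; exact Nat.lt_floor_add_one Y
  have hmY' : (m : ℝ) ≤ Y + 1 := by rw [hm]; push_cast; linarith [Nat.floor_le hY0.le]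
  have hρ0 : 0 ≤ ρ := le_trans (by positivity) hρ
  obtain ⟨c, s, hcs, htilt, hs, -, hc1, hcρ, hc, hτ'⟩ := exists_tilt (n := m) (ρ := ρ) hY0 hmY.le
    (by
      refine le_trans ?_ hρ
      gcongr
      linarith) (by linarith)
  have hc2 : 1 / 2 ≤ c := by nlinarith
  have htτ : s / c ≤ τ := hτ'.trans hτ
  set t := s / c with ht
  have ht0 : 0 ≤ t := by positivity
  have hYt : Y * t ≤ Y * τ := by gcongr
  have hw0 : 0 ≤ l - 2 * b₀ - Y * t := by linarith
  set K := ⌊c * (l - 2 * b₀ - Y * t)⌋₊ with hK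
  have hK1 : (K : ℝ) ≤ c * (l - 2 * b₀ - Y * t) := Nat.floor_le (by positivity)
  have hK2 : c * (l - 2 * b₀ - Y * t) < K + 1 := Nat.lt_floor_add_one _
  obtain ⟨P, hP⟩ : ∃ P : ℝ, P = K / c := ⟨_, rfl⟩
  have hPK : (K : ℝ) = c * P := by rw [hP]; field_simp
  have hP0 : 0 ≤ P := by rw [hP]; positivity
  have hP1 : P ≤ l - 2 * b₀ - Y * t := le_of_mul_le_mul_left (by linarith) hc
  have hP2 : l - 2 * b₀ - Y * t - P ≤ 2 := by nlinarith
  obtain ⟨N, hN, hle⟩ := hE b₀ t le_rfl (by linarith) ht0 htτ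
  obtain ⟨N', hN', hle'⟩ := hE (l - b₀ - Y * t - P) t (by linarith) (by linarith) ht0 htτ
  refine ⟨_, packs_strip_of_ends (K := K) hcs hc hs htilt hb₀ (by linarith)
    (by rw [← hP]; ring) hN hN', ?_⟩
  push_cast
  have hct : c * t = s := by rw [ht]; field_simp
  have hKm : (K : ℝ) * m = P * Y - P * s := by rw [hPK]; linear_combination P * htilt
  have hPs : P * s ≤ l * τ := by
    have h1 : s ≤ t := by rw [← hct]; nlinarith
    have h2 : 0 ≤ Y * t := by positivity
    have h3 : P ≤ l := by linarith
    have h4 : 0 ≤ l := by linarith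
    exact mul_le_mul h3 (h1.trans htτ) hs.le h4
  rw [hKm]
  linarith

/-- An L-shaped border of two strips around a perfectly packed rectangle with integer sides. -/
theorem packs_rectangle_of_strips {x x' Y Z : ℝ} {m n N N' : ℕ} (hx : x = m + Z)
    (hx' : x' = n + Y) (hY : 0 ≤ Y) (hZ : 0 ≤ Z) (hN : Packs (rectangle x Y) N)
    (hN' : Packs (rectangle n Z) N') : Packs (rectangle x x') (N + (N' + m * n)) := by
  have h10 : (1 : ℝ) ^ 2 + 0 ^ 2 = 1 := by norm_num
  have hm0 : (0 : ℝ) ≤ m := Nat.cast_nonneg _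
  have hn0 : (0 : ℝ) ≤ n := Nat.cast_nonneg _
  have h1 : Packs (rectangle x x' ∩ {p | (n : ℝ) ≤ p 1}) N := by
    refine hN.map (shift 0 n) fun p hp => ?_
    obtain ⟨k1, k2, k3, k4⟩ := hp
    refine ⟨⟨?_, ?_, ?_, ?_⟩, ?_⟩ <;>
      simp only [Set.mem_ofPred_eq, shift_apply_zero, shift_apply_one] <;> linarith
  have h2 : Packs (rectangle x n ∩ {p | (m : ℝ) ≤ p 0}) N' := by
    refine hN'.map (swapCoords.trans (shift m 0)) fun p hp => ?_
    obtain ⟨k1, k2, k3, k4⟩ := hp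
    refine ⟨⟨?_, ?_, ?_, ?_⟩, ?_⟩ <;>
      simp only [Set.mem_ofPred_eq, AffineIsometryEquiv.coe_trans, Function.comp_apply,
        shift_apply_zero, shift_apply_one, swapCoords_apply_zero, swapCoords_apply_one] <;> linarith
  have h3 : Packs (box 1 0 0 (0 + m) 0 (0 + n)) (m * n) := packs_box_nat h10 0 0 m n
  have h4 : Packs (rectangle x n) (N' + m * n) := by
    refine h2.union h3 ⟨-1, 0, -m, by simp, fun p hp => ?_, fun p hp => ?_⟩
      Set.inter_subset_left fun p hp => ?_
    · have : (m : ℝ) ≤ p 0 := hp.2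
      linarith
    · have := (mem_box_one_zero.1 hp).2.1
      linarith
    · obtain ⟨k1, k2, k3, k4⟩ := mem_box_one_zero.1 hp
      exact ⟨k1, by linarith, k3, by linarith⟩
  refine h1.union h4 ⟨0, -1, -n, by simp, fun p hp => ?_, fun p hp => ?_⟩
    Set.inter_subset_left fun p hp => ?_
  · have : (n : ℝ) ≤ p 1 := hp.2
    linarith
  · have := hp.2.2.2
    linarith
  · obtain ⟨k1, k2, k3, k4⟩ := hp
    exact ⟨k1, k2, k3, by linarith⟩

/-- The waste of a rectangle in terms of the width `Y₀` of the tilted strips along two of its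
edges, a bound `τ ≈ √(2 / Y₀)` for the tangent of the tilt, and a bound `E` for the waste of the
end trapezoids, whose top edges are about `b₀`. -/
theorem exists_packs_rectangle {x x' Y₀ b₀ τ ρ E : ℝ} (hY₀ : 1 ≤ Y₀) (hb₀ : 0 ≤ b₀)
    (hρ : 1 / Y₀ + √(1 / (2 * Y₀)) ≤ ρ) (hρ1 : ρ ≤ 1 / 2) (hτ : 2 * ρ / (1 - ρ ^ 2) ≤ τ)
    (hx : Y₀ ≤ x) (hx' : Y₀ ≤ x') (hl : 2 * b₀ + (Y₀ + 1) * τ ≤ x) (hE0 : 0 ≤ E)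
    (hE : ∀ Y b t, Y₀ ≤ Y → Y ≤ Y₀ + 1 → b₀ ≤ b → b ≤ b₀ + 2 → 0 ≤ t → t ≤ τ →
      ∃ N : ℕ, Packs (slopeTrapezoid Y b t) N ∧ Y * b + Y ^ 2 * t / 2 - N ≤ E) :
    ∃ N : ℕ, Packs (rectangle x x') N ∧
      x * x' - N ≤ (x + x') * τ + 4 * E + (2 * b₀ + (Y₀ + 1) * τ) := by
  have h10 : (1 : ℝ) ^ 2 + 0 ^ 2 = 1 := by norm_num
  have hρ0 : 0 ≤ ρ := le_trans (by positivity) hρ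
  have hτ0 : 0 ≤ τ := by
    refine le_trans (div_nonneg (by linarith) ?_) hτ
    nlinarith
  have hstrip : ∀ l Y, Y₀ ≤ Y → Y ≤ Y₀ + 1 → 2 * b₀ + (Y₀ + 1) * τ ≤ l →
      ∃ N : ℕ, Packs (rectangle l Y) N ∧ l * Y - N ≤ l * τ + 2 * E := by
    intro l Y h1 h2 h3
    refine exists_packs_strip (by linarith) hb₀ (le_trans ?_ hρ) hρ1 hτ ?_
      (fun b t => hE Y b t h1 h2)
    · gcongr
    · have : Y * τ ≤ (Y₀ + 1) * τ := by gcongr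
      linarith
  have hsplit : ∀ y, Y₀ ≤ y → Y₀ ≤ y - ⌊y - Y₀⌋₊ ∧ y - ⌊y - Y₀⌋₊ ≤ Y₀ + 1 := by
    intro y hy
    have h1 := Nat.floor_le (sub_nonneg.2 hy)
    have h2 := Nat.lt_floor_add_one (y - Y₀)
    constructor <;> linarith
  obtain ⟨hY1, hY2⟩ := hsplit x' hx'
  obtain ⟨hZ1, hZ2⟩ := hsplit x hx
  set n := ⌊x' - Y₀⌋₊
  set m := ⌊x - Y₀⌋₊
  obtain ⟨N, hN, hle⟩ := hstrip x (x' - n) hY1 hY2 hl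
  have hside : ∃ N' : ℕ, Packs (rectangle n (x - m)) N' ∧
      n * (x - m) - N' ≤ n * τ + 2 * E + (2 * b₀ + (Y₀ + 1) * τ) := by
    by_cases hn : 2 * b₀ + (Y₀ + 1) * τ ≤ n
    · obtain ⟨N', hN', hle'⟩ := hstrip n (x - m) hZ1 hZ2 hn
      refine ⟨N', hN', ?_⟩
      have : 0 ≤ (Y₀ + 1) * τ := by positivity
      linarith
    · -- a short strip is packed by rows of full length, which waste at most its length
      push Not at hn
      have h0 : 0 ≤ x - m := by linarith
      refine ⟨n * ⌊x - m⌋₊, (packs_box_nat h10 0 0 n ⌊x - m⌋₊).mono fun p hp => ?_, ?_⟩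
      · obtain ⟨k1, k2, k3, k4⟩ := mem_box_one_zero.1 hp
        have := Nat.floor_le h0
        exact ⟨k1, by linarith, k3, by linarith⟩
      · have h1 := Nat.lt_floor_add_one (x - m)
        have h2 : (n : ℝ) * (x - m) ≤ n * (⌊x - m⌋₊ + 1) := by gcongr
        have h3 : 0 ≤ (n : ℝ) * τ := by positivity
        push_cast
        linarith
  obtain ⟨N', hN', hle'⟩ := hside
  refine ⟨_, packs_rectangle_of_strips (Y := x' - n) (Z := x - m) (by ring) (by ring)
    (by linarith) (by linarith) hN hN', ?_⟩
  push_cast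
  have : (n : ℝ) * τ ≤ x' * τ := by gcongr; linarith
  linarith

/-! ### Bounds for the packing waste -/

theorem volume_rectangle_ne_top {l w : ℝ} (hl : 0 ≤ l) (hw : 0 ≤ w) :
    volume (rectangle l w) ≠ ⊤ := by
  rw [rectangle_eq_slopeTrapezoid, volume_slopeTrapezoid hw hl le_rfl]
  exact ENNReal.ofReal_ne_top

theorem Packs.packingWaste_rectangle_le {l w : ℝ} (hl : 0 ≤ l) (hw : 0 ≤ w) {N : ℕ}
    (hN : Packs (rectangle l w) N) : packingWaste (rectangle l w) ≤ l * w - N := by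
  rw [rectangle_eq_slopeTrapezoid] at hN ⊢
  refine (hN.packingWaste_slopeTrapezoid_le hw hl le_rfl).trans_eq ?_
  ring

theorem packingWaste_rectangle_le_add {l w : ℝ} (hl : 0 ≤ l) (hw : 0 ≤ w) :
    packingWaste (rectangle l w) ≤ l + w := by
  obtain ⟨N, hN, hle⟩ := exists_packs_aligned_rows hw hl (le_refl (0 : ℝ))
  rw [rectangle_eq_slopeTrapezoid]
  refine (hN.packingWaste_slopeTrapezoid_le hw hl le_rfl).trans (hle.trans_eq ?_)
  ring

/-- Strips of width `x ^ (2 / 3)` with end trapezoids packed by aligned rows; here `z ^ 3` is the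
length of the rectangle. -/
theorem packingWaste_rectangle_le_of_aligned_ends {z x' : ℝ} (hz : 6 ≤ z) (hx' : z ^ 2 ≤ x') :
    packingWaste (rectangle (z ^ 3) x') ≤ 9 / 5 * (z ^ 3 + x') / z + 6 * z ^ 2 := by
  have hz0 : 0 < z := by linarith
  have hz1 : z * (1 / z) = 1 := by field_simp
  have hiz : 1 / z ≤ 1 / 6 := by gcongr
  have hiz0 : 0 < 1 / z := by positivity
  have hz2 : 36 ≤ z ^ 2 := by nlinarith
  have hz3 : z ^ 3 = z ^ 2 * z := by ring
  obtain ⟨y, hy⟩ : ∃ y, y = 1 / z := ⟨_, rfl⟩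
  rw [← hy] at hz1 hiz hiz0
  have hρ : 1 / z ^ 2 + √(1 / (2 * z ^ 2)) ≤ 22 / 25 * y := by
    have h1 : √(1 / (2 * z ^ 2)) ≤ 71 / 100 * y := by
      refine Real.sqrt_le_iff.2 ⟨by positivity, ?_⟩
      have : 1 / (2 * z ^ 2) = 1 / 2 * y ^ 2 := by rw [hy]; field_simp
      rw [this]
      nlinarith [sq_nonneg y]
    have h2 : 1 / z ^ 2 = y * y := by rw [hy]; field_simp
    nlinarith
  have hτ : 2 * (22 / 25 * y) / (1 - (22 / 25 * y) ^ 2) ≤ 9 / 5 * y := by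
    rw [div_le_iff₀ (by nlinarith)]
    nlinarith [mul_nonneg hiz0.le (sq_nonneg y), mul_nonneg hiz0.le hiz0.le]
  have hτz : (z ^ 2 + 1) * (9 / 5 * y) = 9 / 5 * z + 9 / 5 * y := by
    linear_combination (9 / 5 * z) * hz1
  obtain ⟨N, hN, hle⟩ := exists_packs_rectangle (x := z ^ 3) (x' := x') (Y₀ := z ^ 2) (b₀ := 0)
    (τ := 9 / 5 * y) (ρ := 22 / 25 * y) (E := 13 / 10 * z ^ 2) (by linarith) le_rfl hρ
    (by linarith) hτ (by nlinarith) hx' (by rw [hτz]; nlinarith) (by positivity) (by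
      intro Y b t hY hY' hb hb' ht ht'
      obtain ⟨N, hN, hle⟩ := exists_packs_aligned_rows (h := Y) (by linarith) hb ht
      refine ⟨N, hN, hle.trans ?_⟩
      have h1 : t * (Y + 1) ≤ 9 / 5 * y * (z ^ 2 + 2) := by
        exact mul_le_mul ht' (by linarith) (by linarith) (by positivity)
      have h2 : 9 / 5 * y * (z ^ 2 + 2) = 9 / 5 * z + 18 / 5 * y := by
        linear_combination (9 / 5 * z) * hz1
      nlinarith)
  have hx0 : 0 ≤ x' := by linarith
  refine (hN.packingWaste_rectangle_le (by positivity) hx0).trans (hle.trans ?_)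
  rw [hτz]
  have e1 : 9 / 5 * (z ^ 3 + x') / z = (z ^ 3 + x') * (9 / 5 * y) := by rw [hy]; field_simp
  rw [e1]
  nlinarith

/-- Strips of width `x ^ (3 / 4)` with end trapezoids packed by tilted rows; here `w ^ 24` is the
length of the rectangle. -/
theorem packingWaste_rectangle_le_of_tilted_ends {w x' : ℝ} (hw : 3 ≤ w) (hx' : w ^ 18 ≤ x') :
    packingWaste (rectangle (w ^ 24) x') ≤
      29 / 20 * (w ^ 24 + x') / w ^ 9 + 33 * w ^ 15 := by
  have hw0 : 0 < w := by linarith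
  have hw3 : 27 ≤ w ^ 3 := by
    calc (27 : ℝ) = 3 ^ 3 := by norm_num
      _ ≤ w ^ 3 := by gcongr
  obtain ⟨v, hv⟩ : ∃ v, v = w ^ 3 := ⟨_, rfl⟩
  have e24 : w ^ 24 = v ^ 8 := by rw [hv]; ring
  have e18 : w ^ 18 = v ^ 6 := by rw [hv]; ring
  have e15 : w ^ 15 = v ^ 5 := by rw [hv]; ring
  have e9 : w ^ 9 = v ^ 3 := by rw [hv]; ring
  rw [e24, e15, e9]
  rw [e18] at hx'
  rw [← hv] at hw3
  clear hv e24 e18 e15 e9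
  have hv0 : 0 < v := by linarith
  have hv3 : (19683 : ℝ) ≤ v ^ 3 := by
    calc (19683 : ℝ) = 27 ^ 3 := by norm_num
      _ ≤ v ^ 3 := by gcongr
  obtain ⟨q, hq⟩ : ∃ q, q = v ^ 3 := ⟨_, rfl⟩
  obtain ⟨y, hy⟩ : ∃ y, y = 1 / v ^ 3 := ⟨_, rfl⟩
  have hy0 : 0 < y := by rw [hy]; positivity
  have hqy : q * y = 1 := by rw [hy, hq]; field_simp
  have hy1 : y ≤ 1 / 19683 := by rw [hy]; gcongr
  have hv6 : v ^ 6 = q ^ 2 := by rw [hq]; ring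
  rw [← hq] at hv3
  have hq0 : 0 < q := by linarith
  have hρ : 1 / v ^ 6 + √(1 / (2 * v ^ 6)) ≤ 177 / 250 * y := by
    have h1 : √(1 / (2 * v ^ 6)) ≤ 7072 / 10000 * y := by
      refine Real.sqrt_le_iff.2 ⟨by positivity, ?_⟩
      have : 1 / (2 * v ^ 6) = 1 / 2 * y ^ 2 := by rw [hy]; field_simp
      rw [this]
      nlinarith [sq_nonneg y]
    have h2 : 1 / v ^ 6 = y * y := by rw [hy]; field_simp
    nlinarith
  have hτ : 2 * (177 / 250 * y) / (1 - (177 / 250 * y) ^ 2) ≤ 29 / 20 * y := by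
    rw [div_le_iff₀ (by nlinarith)]
    nlinarith [mul_nonneg hy0.le (sq_nonneg y), mul_nonneg hy0.le hy0.le]
  have hτz : (v ^ 6 + 1) * (29 / 20 * y) = 29 / 20 * q + 29 / 20 * y := by
    rw [hv6]; linear_combination (29 / 20 * q) * hqy
  have hv2 : 729 ≤ v ^ 2 := by nlinarith
  have hqv : q = v ^ 2 * v := by rw [hq]; ring
  have hq27 : 27 * v ^ 2 ≤ q := by rw [hqv]; nlinarith
  have hv5 : v ^ 5 = q * v ^ 2 := by rw [hq]; ring
  have hv8 : v ^ 8 = q * q * v ^ 2 := by rw [hq]; ring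
  have hv5q : 729 * q ≤ v ^ 5 := by rw [hv5]; nlinarith
  have hv5' : 19683 * v ^ 2 ≤ v ^ 5 := by rw [hv5]; nlinarith [sq_nonneg v]
  have hv68 : 729 * v ^ 6 ≤ v ^ 8 := by
    have : v ^ 8 = v ^ 2 * v ^ 6 := by ring
    rw [this]; gcongr
  have hv6' : q ≤ v ^ 6 := by rw [hv6]; nlinarith
  obtain ⟨N, hN, hle⟩ := exists_packs_rectangle (x := v ^ 8) (x' := x') (Y₀ := v ^ 6)
    (b₀ := 2 * v ^ 2)
    (τ := 29 / 20 * y) (ρ := 177 / 250 * y) (E := 81 / 10 * v ^ 5) (by linarith) (by positivity)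
    hρ (by linarith) hτ (by linarith) hx' (by rw [hτz]; linarith) (by positivity) (by
      intro Y b t hY hY' hb hb' ht ht'
      obtain ⟨z, hz, hzY⟩ : ∃ z : ℝ, 0 ≤ z ∧ z ^ 6 = Y := by
        have hY0 : 0 ≤ Y := by linarith [pow_pos hv0 6]
        refine ⟨Y ^ (1 / 6 : ℝ), by positivity, ?_⟩
        rw [← Real.rpow_natCast, ← Real.rpow_mul hY0]
        norm_num
      have hvz : v ≤ z := by
        rw [← hzY] at hY
        exact le_of_pow_le_pow_left₀ (by norm_num) hz hY
      have hzv : z ≤ 1001 / 1000 * v := by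
        refine le_of_pow_le_pow_left₀ (n := 6) (by norm_num) (by positivity) ?_
        rw [hzY, mul_pow]
        norm_num
        linarith
      have hz3 : z ^ 3 ≤ (1001 / 1000 * v) ^ 3 := by gcongr
      have hz3' : v ^ 3 ≤ z ^ 3 := by gcongr
      have hz2 : z ^ 2 ≤ (1001 / 1000 * v) ^ 2 := by gcongr
      have hz5 : z ^ 5 ≤ (1001 / 1000 * v) ^ 5 := by gcongr
      rw [mul_pow] at hz3 hz2 hz5
      obtain ⟨N, hN, hle⟩ := exists_packs_tall_trapezoid (z := z) (b := b) (t := t) (by linarith)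
        (by linarith) (by linarith) ht (by
          calc t * z ^ 3 ≤ (29 / 20 * y) * ((1001 / 1000) ^ 3 * v ^ 3) := by gcongr
            _ = 29 / 20 * (1001 / 1000) ^ 3 * (q * y) := by rw [hq]; ring
            _ ≤ 3 / 2 := by rw [hqy]; norm_num)
      rw [hzY] at hN hle
      exact ⟨N, hN, by linarith⟩)
  have hx0 : 0 ≤ x' := by linarith
  refine (hN.packingWaste_rectangle_le (by positivity) hx0).trans (hle.trans ?_)
  rw [hτz]
  have e1 : 29 / 20 * (v ^ 8 + x') / v ^ 3 = (v ^ 8 + x') * (29 / 20 * y) := by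
    rw [hy]; field_simp
  rw [e1]
  linarith

/-- The cases of the proof differ in the packing used: rows only for `x ≤ 256`, strips with simple
ends for `x ≤ 3 ^ 24`, where `x ^ (2 / 3) ≤ 3 x ^ (5 / 8)`, and strips with carefully packed ends
beyond. -/
theorem packingWaste_rectangle_le {c x x' : ℝ} (hc : c ≤ 7) (hx : 0 < x)
    (hxx' : x ^ (3 / 4 : ℝ) ≤ x') (hx'c : x' ≤ c * x) :
    packingWaste (rectangle x x') ≤ ((15 + c) * √2 + 38) * x ^ (5 / 8 : ℝ) := by
  have hx34 : 0 < x ^ (3 / 4 : ℝ) := by positivity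
  have hx'0 : 0 < x' := by linarith
  have hc0 : 0 < c := pos_of_mul_pos_left (by linarith : 0 < c * x) hx.le
  have hsqrt : 1.4142 ≤ √2 := Real.le_sqrt_of_sq_le (by norm_num)
  have hconst : 59.2 + 1.4142 * c ≤ (15 + c) * √2 + 38 := by nlinarith
  -- all exponents that occur are multiples of `1 / 24`
  obtain ⟨w, hw⟩ : ∃ w, w = x ^ (1 / 24 : ℝ) := ⟨_, rfl⟩
  have hw0 : 0 < w := by rw [hw]; positivity
  have hpow : ∀ k : ℕ, w ^ k = x ^ ((k : ℝ) / 24) := by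
    intro k
    rw [hw, ← Real.rpow_natCast, ← Real.rpow_mul hx.le]
    congr 1; ring
  have hw24 : w ^ 24 = x := by rw [hpow]; norm_num
  have hw15 : w ^ 15 = x ^ (5 / 8 : ℝ) := by rw [hpow]; norm_num
  have hw18 : w ^ 18 = x ^ (3 / 4 : ℝ) := by rw [hpow]; norm_num
  rw [← hw15]
  rw [← hw18] at hxx'
  refine le_trans ?_ (mul_le_mul_of_nonneg_right hconst (by positivity))
  have hw15p : 0 < w ^ 15 := by positivity
  by_cases h1 : x ≤ 256
  · refine (packingWaste_rectangle_le_add hx.le hx'0.le).trans ?_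
    have hw9 : w ^ 9 ≤ 8 := by
      have : (w ^ 9) ^ 8 ≤ 8 ^ 8 := by
        calc (w ^ 9) ^ 8 = (w ^ 24) ^ 3 := by ring
          _ ≤ 256 ^ 3 := by rw [hw24]; gcongr
          _ = 8 ^ 8 := by norm_num
      exact le_of_pow_le_pow_left₀ (by norm_num) (by norm_num) this
    have h2 : x = w ^ 9 * w ^ 15 := by rw [← hw24]; ring
    have h3 : x ≤ 8 * w ^ 15 := by rw [h2]; gcongr
    have h4 : x + x' ≤ (1 + c) * (8 * w ^ 15) := by
      calc x + x' ≤ (1 + c) * x := by linarith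
        _ ≤ _ := by gcongr
    nlinarith
  push Not at h1
  by_cases h2 : w ≤ 3
  · have hw8 : 6 ≤ w ^ 8 := by
      have : (6 : ℝ) ^ 3 ≤ (w ^ 8) ^ 3 := by
        calc (6 : ℝ) ^ 3 ≤ 256 := by norm_num
          _ ≤ w ^ 24 := by rw [hw24]; exact h1.le
          _ = _ := by ring
      exact le_of_pow_le_pow_left₀ (by norm_num) (by positivity) this
    have hw1 : 1 ≤ w := by
      by_contra! hcon
      have : w ^ 8 ≤ 1 := pow_le_one₀ hw0.le hcon.le
      linarith
    have h3 := packingWaste_rectangle_le_of_aligned_ends (z := w ^ 8) (x' := x') hw8 (by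
      calc (w ^ 8) ^ 2 = w ^ 16 := by ring
        _ ≤ w ^ 18 := pow_le_pow_right₀ hw1 (by norm_num)
        _ ≤ x' := hxx')
    rw [show (w ^ 8) ^ 3 = x by rw [← hw24]; ring] at h3
    refine h3.trans ?_
    have h4 : 9 / 5 * (x + x') / w ^ 8 ≤ 9 / 5 * (1 + c) * w ^ 16 := by
      rw [div_le_iff₀ (by positivity)]
      have : w ^ 16 * w ^ 8 = x := by rw [← hw24]; ring
      rw [mul_assoc, this]
      linarith
    have h5 : w ^ 16 ≤ 3 * w ^ 15 := by
      calc w ^ 16 = w * w ^ 15 := by ring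
        _ ≤ _ := by gcongr
    have h6 : (w ^ 8) ^ 2 = w ^ 16 := by ring
    rw [h6]
    nlinarith [mul_le_mul_of_nonneg_left h5 hc0.le]
  · push Not at h2
    have h3 := packingWaste_rectangle_le_of_tilted_ends h2.le hxx'
    rw [hw24] at h3
    refine h3.trans ?_
    have h4 : 29 / 20 * (x + x') / w ^ 9 ≤ 29 / 20 * (1 + c) * w ^ 15 := by
      rw [div_le_iff₀ (by positivity)]
      have : w ^ 15 * w ^ 9 = x := by rw [← hw24]; ring
      rw [mul_assoc, this]
      linarith
    nlinarith

theorem packingWaste_square_le {x : ℝ} (hx : 0 < x) :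
    packingWaste (rectangle x x) ≤ (16 * √2 + 38) * x ^ (5 / 8 : ℝ) := by
  by_cases h1 : x ≤ 1
  · refine (packingWaste_rectangle_le_add hx.le hx.le).trans ?_
    have h2 : x ≤ x ^ (5 / 8 : ℝ) := by
      calc x = x ^ (1 : ℝ) := (Real.rpow_one x).symm
        _ ≤ _ := Real.rpow_le_rpow_of_exponent_ge hx h1 (by norm_num)
    have h3 := Real.sqrt_nonneg 2
    nlinarith
  · push Not at h1
    have h2 : x ^ (3 / 4 : ℝ) ≤ x := by
      calc x ^ (3 / 4 : ℝ) ≤ x ^ (1 : ℝ) := Real.rpow_le_rpow_of_exponent_le h1.le (by norm_num)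
        _ = x := Real.rpow_one x
    refine (packingWaste_rectangle_le (c := 1) (by norm_num) hx h2 (by linarith)).trans_eq ?_
    norm_num

theorem isBigO_packingWaste_square :
    (fun x : ℝ => packingWaste (rectangle x x)) =O[atTop] (fun x : ℝ => x ^ (5 / 8 : ℝ)) := by
  refine IsBigO.of_bound (16 * √2 + 38) ?_
  filter_upwards [eventually_gt_atTop 0] with x hx
  rw [Real.norm_of_nonneg (packingWaste_nonneg (volume_rectangle_ne_top hx.le hx.le)),
    Real.norm_of_nonneg (by positivity)]
  exact packingWaste_square_le hx

/-- The slopes allowed for the trapezoids are about `√2 x ^ (-1 / 2)` at most. -/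
theorem eventually_tan_le {θ : ℝ → ℝ}
    (hθ : ∀ᶠ x in atTop, 0 < θ x ∧ θ x < √2 * x ^ (-(1 / 2) : ℝ)) :
    ∀ᶠ x in atTop, 0 ≤ Real.tan (θ x) ∧ Real.tan (θ x) * x ^ (1 / 2 : ℝ) ≤ 29 / 20 := by
  filter_upwards [hθ, eventually_ge_atTop 200] with x ⟨h1, h2⟩ hx
  have hx0 : 0 < x := by linarith
  have hs0 := Real.sqrt_nonneg 2
  have hs2 : √2 ^ 2 = 2 := Real.sq_sqrt (by norm_num)
  have hsqrt : √2 ≤ 1.4143 := Real.sqrt_le_iff.2 (by norm_num)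
  have hy : x ^ (-(1 / 2) : ℝ) * x ^ (1 / 2 : ℝ) = 1 := by
    rw [← Real.rpow_add hx0]; norm_num
  have hy2 : (x ^ (1 / 2 : ℝ)) ^ 2 = x := by
    rw [← Real.rpow_natCast, ← Real.rpow_mul hx0.le]; norm_num
  obtain ⟨v, hv⟩ : ∃ v, v = x ^ (1 / 2 : ℝ) := ⟨_, rfl⟩
  have hv0 : 0 < v := by rw [hv]; positivity
  rw [← hv] at hy hy2 ⊢
  have h3 : θ x * v ≤ √2 := by
    calc θ x * v ≤ √2 * x ^ (-(1 / 2) : ℝ) * v := by gcongr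
      _ = √2 := by rw [mul_assoc, hy, mul_one]
  have h4 : θ x ^ 2 ≤ 1 / 100 := by
    have : (θ x * v) ^ 2 ≤ √2 ^ 2 := by gcongr
    rw [mul_pow, hs2, hy2] at this
    nlinarith [sq_nonneg (θ x)]
  have h5 : 0.99 ≤ Real.cos (θ x) := by
    have := Real.one_sub_sq_div_two_le_cos (x := θ x)
    linarith
  have h6 : Real.sin (θ x) ≤ θ x := Real.sin_le h1.le
  have h7 : 0 ≤ Real.sin (θ x) :=
    Real.sin_nonneg_of_nonneg_of_le_pi h1.le (by nlinarith [Real.pi_gt_three])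
  rw [Real.tan_eq_sin_div_cos]
  refine ⟨div_nonneg h7 (by linarith), ?_⟩
  rw [div_mul_eq_mul_div, div_le_iff₀ (by linarith)]
  have : Real.sin (θ x) * v ≤ θ x * v := by gcongr
  linarith

theorem eventually_abs_sub_le_of_isEquivalent {f g : ℝ → ℝ} (h : IsEquivalent atTop f g) {ε : ℝ}
    (hε : 0 < ε) : ∀ᶠ x in atTop, |f x - g x| ≤ ε * |g x| :=
  h.isLittleO.bound hε

theorem eventually_packingWaste_tall_trapezoid_le {x' θ : ℝ → ℝ}
    (hx' : IsEquivalent atTop x' (fun x => 2 * x ^ (1 / 2 : ℝ)))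
    (hθ : ∀ᶠ x in atTop, 0 < θ x ∧ θ x < √2 * x ^ (-(1 / 2) : ℝ)) :
    ∀ᶠ x in atTop, packingWaste (trapezoid x (x' x) (θ x)) ≤
      (19 / 2 + 7 / 2 * √2) * x ^ (5 / 6 : ℝ) := by
  filter_upwards [eventually_tan_le hθ,
    eventually_abs_sub_le_of_isEquivalent hx' (by norm_num : (0 : ℝ) < 1 / 2),
    eventually_ge_atTop (16 ^ 6 : ℝ)] with x ⟨ht0, ht⟩ hb hx
  have hx0 : 0 < x := lt_of_lt_of_le (by norm_num) hx
  obtain ⟨z, hz⟩ : ∃ z, z = x ^ (1 / 6 : ℝ) := ⟨_, rfl⟩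
  have hz0 : 0 < z := by rw [hz]; positivity
  have hpow : ∀ k : ℕ, z ^ k = x ^ ((k : ℝ) / 6) := by
    intro k
    rw [hz, ← Real.rpow_natCast, ← Real.rpow_mul hx0.le]
    congr 1; ring
  have hz6 : z ^ 6 = x := by rw [hpow]; norm_num
  have hz5 : z ^ 5 = x ^ (5 / 6 : ℝ) := by rw [hpow]; norm_num
  have hz3 : z ^ 3 = x ^ (1 / 2 : ℝ) := by rw [hpow]; norm_num
  have hz16 : 16 ≤ z := by
    rw [← hz6] at hx
    exact le_of_pow_le_pow_left₀ (by norm_num) hz0.le hx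
  rw [← hz3] at ht hb
  rw [← hz5]
  rw [abs_of_pos (by positivity : 0 < 2 * z ^ 3), abs_le] at hb
  have hz23 : z ^ 2 ≤ z ^ 3 := pow_le_pow_right₀ (by linarith) (by norm_num)
  obtain ⟨N, hN, hle⟩ := exists_packs_tall_trapezoid hz16 (b := x' x) (t := Real.tan (θ x))
    (by linarith) (by linarith) ht0 (by linarith)
  rw [hz6] at hN hle
  rw [trapezoid_eq_slopeTrapezoid]
  have hb0 : 0 ≤ x' x := by
    have : 0 < z ^ 3 := by positivity
    linarith
  refine (hN.packingWaste_slopeTrapezoid_le hx0.le hb0 ht0).trans (hle.trans ?_)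
  gcongr
  have := Real.sqrt_nonneg 2
  linarith

theorem eventually_packingWaste_steep_trapezoid_le {h θ : ℝ → ℝ}
    (hh : IsEquivalent atTop h (fun x => 1 / 2 * x ^ (1 / 2 : ℝ)))
    (hθ : ∀ᶠ x in atTop, 0 < θ x ∧ θ x < √2 * x ^ (-(1 / 2) : ℝ)) :
    ∀ᶠ x in atTop,
      packingWaste
        (trapezoid (h x) (⌊x ^ (1 / 3 : ℝ) + √2 * x ^ (1 / 6 : ℝ)⌋ : ℝ) (θ x)) ≤
      (19 / 4 + 7 / 4 * √2) * x ^ (1 / 3 : ℝ) := by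
  filter_upwards [eventually_tan_le hθ,
    eventually_abs_sub_le_of_isEquivalent hh (by norm_num : (0 : ℝ) < 1 / 100),
    eventually_ge_atTop (100 ^ 6 : ℝ)] with x ⟨ht0, ht⟩ hb hx
  have hx0 : 0 < x := lt_of_lt_of_le (by norm_num) hx
  obtain ⟨z, hz⟩ : ∃ z, z = x ^ (1 / 6 : ℝ) := ⟨_, rfl⟩
  have hz0 : 0 < z := by rw [hz]; positivity
  have hpow : ∀ k : ℕ, z ^ k = x ^ ((k : ℝ) / 6) := by
    intro k
    rw [hz, ← Real.rpow_natCast, ← Real.rpow_mul hx0.le]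
    congr 1; ring
  have hz6 : z ^ 6 = x := by rw [hpow]; norm_num
  have hz3 : z ^ 3 = x ^ (1 / 2 : ℝ) := by rw [hpow]; norm_num
  have hz2 : z ^ 2 = x ^ (1 / 3 : ℝ) := by rw [hpow]; norm_num
  have hz100 : 100 ≤ z := by
    rw [← hz6] at hx
    exact le_of_pow_le_pow_left₀ (by norm_num) hz0.le hx
  rw [← hz3] at ht hb
  rw [← hz2, ← hz]
  rw [abs_of_pos (by positivity : 0 < 1 / 2 * z ^ 3), abs_le] at hb
  have hs1 : 1.4142 ≤ √2 := Real.le_sqrt_of_sq_le (by norm_num)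
  have hs2 : √2 ≤ 1.4143 := Real.sqrt_le_iff.2 (by norm_num)
  set a : ℝ := (⌊z ^ 2 + √2 * z⌋ : ℝ) with ha
  have hsz1 : 1.4142 * z ≤ √2 * z := by gcongr
  have hsz2 : √2 * z ≤ 1.4143 * z := by gcongr
  have ha1 : a ≤ z ^ 2 + √2 * z := Int.floor_le _
  have ha2 : z ^ 2 + √2 * z < a + 1 := Int.lt_floor_add_one _
  have hzz : 100 * z ≤ z ^ 2 := by nlinarith
  have hzz3 : 10000 * z ≤ z ^ 3 := by
    have : z ^ 3 = z ^ 2 * z := by ring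
    rw [this]; nlinarith
  have hsq1 : z ≤ √a := Real.le_sqrt_of_sq_le (by linarith)
  have hsq2 : √a ≤ 102 / 100 * z := Real.sqrt_le_iff.2 ⟨by positivity, by nlinarith⟩
  have hh0 : 0 ≤ h x := by linarith
  have hht : h x * Real.tan (θ x) ≤ 3 / 4 := by
    have : h x * Real.tan (θ x) ≤ 101 / 200 * z ^ 3 * Real.tan (θ x) := by
      gcongr; linarith
    linarith
  obtain ⟨N, hN, hle⟩ := exists_packs_steep_trapezoid (h := h x) (b := a) (t := Real.tan (θ x))
    (by linarith) ht0 hht (by linarith)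
  rw [trapezoid_eq_slopeTrapezoid]
  refine (hN.packingWaste_slopeTrapezoid_le hh0 (by linarith) ht0).trans (hle.trans ?_)
  have h1 : h x / √a ≤ 101 / 200 * z ^ 2 := by
    calc h x / √a ≤ 101 / 200 * z ^ 3 / z := by
          gcongr
          linarith
      _ = _ := by field_simp
  have h2 : (4.75 + 1.75 * 1.4142) * z ^ 2 ≤ (19 / 4 + 7 / 4 * √2) * z ^ 2 := by
    refine mul_le_mul_of_nonneg_right ?_ (by positivity)
    linarith
  refine le_trans ?_ h2
  linarith

theorem theorem1 :
    -- Type 1: rectangles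
    (∀ c x x' : ℝ, c ≤ 7 → 0 < x → x ^ (3 / 4 : ℝ) ≤ x' → x' ≤ c * x →
      packingWaste (rectangle x x') ≤ ((15 + c) * √2 + 38) * x ^ (5 / 8 : ℝ)) ∧
    -- Type 2: trapezoids of height `x` and top edge `x' ∼ 2 x ^ (1 / 2)`
    (∀ x' θ : ℝ → ℝ,
      IsEquivalent atTop x' (fun x => 2 * x ^ (1 / 2 : ℝ)) →
      (∀ᶠ x in atTop, 0 < θ x ∧ θ x < √2 * x ^ (-(1 / 2) : ℝ)) →
      ∀ᶠ x in atTop, packingWaste (trapezoid x (x' x) (θ x)) ≤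
        (19 / 2 + 7 / 2 * √2) * x ^ (5 / 6 : ℝ)) ∧
    -- Type 3: trapezoids of height `h ∼ (1 / 2) x ^ (1 / 2)` and a prescribed integer top edge
    (∀ h θ : ℝ → ℝ,
      IsEquivalent atTop h (fun x => 1 / 2 * x ^ (1 / 2 : ℝ)) →
      (∀ᶠ x in atTop, 0 < θ x ∧ θ x < √2 * x ^ (-(1 / 2) : ℝ)) →
      ∀ᶠ x in atTop,
        packingWaste
          (trapezoid (h x) (⌊x ^ (1 / 3 : ℝ) + √2 * x ^ (1 / 6 : ℝ)⌋ : ℝ) (θ x)) ≤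
        (19 / 4 + 7 / 4 * √2) * x ^ (1 / 3 : ℝ)) ∧
    -- squares
    (∀ x : ℝ, 0 < x →
      packingWaste (rectangle x x) ≤ (16 * √2 + 38) * x ^ (5 / 8 : ℝ)) ∧
    (fun x : ℝ => packingWaste (rectangle x x)) =O[atTop] (fun x : ℝ => x ^ (5 / 8 : ℝ)) := by
  exact ⟨fun c x x' hc hx h h' => packingWaste_rectangle_le hc hx h h',
    fun x' θ => eventually_packingWaste_tall_trapezoid_le,
    fun h θ => eventually_packingWaste_steep_trapezoid_le,
    fun x hx => packingWaste_square_le hx, isBigO_packingWaste_square⟩
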